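/- Let $d\ge 1$ be an integer, $\alpha\in(0,2)$, and let $f$ be a symmetric probability density on $\mathbb{R}^d$ ($f(-x)=f(x)$) for which there are constants $C_1,C_2>0$ with $$C_1\,(\|x\|_2\vee 1)^{-d-\alpha}\le f(x)\le C_2\,(\|x\|_2\vee 1)^{-d-\alpha}\qquad\text{for all }x\in\mathbb{R}^d .$$ For an integer $L\ge 2$ let $\Lambda_{L,d}=\big((-\tfrac L2,\tfrac L2]\cap\mathbb{Z}\big)^d$, regarded as the discrete torus $(\mathbb{Z}/L\mathbb{Z})^d$, let $N=L^d$ be its number of points, let $[x]_L\in\Lambda_{L,d}$ be the canonical representative of $x$ modulo $L$, and let $\|x\|_2$ denote the Euclidean norm of $[x]_L$. For $W>0$ let $p_n(x)$ be the $n$-step transition probability from $0$ to $x$ of the Markov chain on $\Lambda_{L,d}$ with one-step transition probabilities $$p_1(x,y)=\frac{1}{\Omega_W}f\Big(\frac{[y-x]_L}{W}\Big)\quad (x\ne y),\qquad p_1(x,x)=0,\qquad \Omega_W=\sum_{0\ne x\in\Lambda_{L,d}}f\Big(\frac{x}{W}\Big).$$ Then for every $W_0>0$ there is a constant $C>0$,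 depending only on $d,\alpha,f,W_0$, such that for all integers $L\ge 2$, all real $W\ge W_0$, all integers $n\ge 1$ and all $x\in\Lambda_{L,d}$, $$p_n(x)\le C\left(\Big(\frac{1}{n^{d/\alpha}W^d}\wedge\frac{nW^{\alpha}}{(\|x\|_2\vee W)^{d+\alpha}}\Big)+\frac1N\right).$$ -/

import Mathlib

noncomputable section

namespace CirculantWalk

/-- The discrete torus with side `L` in dimension `d`. Its points are in bijection, through
`rep`, with the integer vectors in the box `(-L/2, L/2]^d`. -/
abbrev Torus (d L : ℕ) : Type := Fin d → ZMod L

/-- The canonical representative `[x]_L`, seen as a vector of the Euclidean space `ℝ^d`. -/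
def rep {d L : ℕ} (x : Torus d L) : EuclideanSpace ℝ (Fin d) :=
  WithLp.toLp 2 fun i => ((x i).valMinAbs : ℝ)

/-- The coordinates of `rep` are the integers congruent to those of `x` in `(-L/2, L/2]`. -/
theorem rep_spec {d L : ℕ} [NeZero L] (x : Torus d L) (i : Fin d) (m : ℤ) :
    rep x i = (m : ℝ) ↔ x i = (m : ZMod L) ∧ -(L : ℝ) / 2 < m ∧ (m : ℝ) ≤ (L : ℝ) / 2 := by
  have h1 : rep x i = ((x i).valMinAbs : ℝ) := rfl
  rw [h1, Int.cast_inj, ZMod.valMinAbs_spec, Set.mem_Ioc]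
  refine and_congr_right fun _ => and_congr ?_ ?_
  · rw [div_lt_iff₀ two_pos]
    exact_mod_cast Iff.rfl
  · rw [le_div_iff₀ two_pos]
    exact_mod_cast Iff.rfl

/-- The periodic Euclidean norm on the torus: the `ℓ²` norm of the canonical representative. -/
def torusNorm {d L : ℕ} (x : Torus d L) : ℝ := ‖rep x‖

/-- `f` is a symmetric probability density on `ℝ^d`. -/
structure IsSymmetricDensity {d : ℕ} (f : EuclideanSpace ℝ (Fin d) → ℝ) : Prop where
  nonneg : ∀ x, 0 ≤ f x
  integrable : MeasureTheory.Integrable f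
  integral_eq_one : ∫ x, f x = 1
  symm : ∀ x, f (-x) = f x

/-- `f ≍ g`: two-sided comparison on the whole space with positive constants. -/
def Comparable {E : Type*} (f g : E → ℝ) : Prop :=
  ∃ C₁ C₂ : ℝ, 0 < C₁ ∧ 0 < C₂ ∧ ∀ x, C₁ * g x ≤ f x ∧ f x ≤ C₂ * g x

/-- The normalization `Ω_W`, the sum of `f (x / W)` over the nonzero points of the torus. -/
def Omega {d : ℕ} (L : ℕ) [NeZero L] (W : ℝ) (f : EuclideanSpace ℝ (Fin d) → ℝ) : ℝ :=
  ∑ x : Torus d L with x ≠ 0, f (W⁻¹ • rep x)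

/-- One-step transition matrix of the circulant random walk with profile `f` and bandwidth `W`.
The off-diagonal entries of each row add up to one, so the diagonal is zero. -/
def transition {d : ℕ} (L : ℕ) [NeZero L] (W : ℝ) (f : EuclideanSpace ℝ (Fin d) → ℝ) :
    Matrix (Torus d L) (Torus d L) ℝ :=
  Matrix.of fun x y => if x = y then 0 else f (W⁻¹ • rep (y - x)) / Omega L W f

/-- The `n`-step transition probability `p_n(x) = p_n(0, x)`. -/
def stepProb {d : ℕ} (L : ℕ) [NeZero L] (W : ℝ) (f : EuclideanSpace ℝ (Fin d) → ℝ)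
    (n : ℕ) (x : Torus d L) : ℝ :=
  (transition L W f ^ n) 0 x

end CirculantWalk

end

/-! The walk is a convolution power of a one-step law that, at the scale `V = max W 1`, is
comparable off the origin with the stable profile `V ^ α * max |x| V ^ (-d - α)`. The sup norm of
the representative replaces the Euclidean one: cubes are easy to count, and wrapping around the
torus can only decrease each coordinate of a sum in absolute value. If `V ≥ L` the profile is
constant on the torus, so a single step is already bounded by a multiple of `1 / N`, and further
convolution preserves this. The rest concerns `V < L`.

On the diagonal, a Nash-type argument controls the energy `∑ pₙ(x)²`. If the kernel is at least `β`
on a set `B`, one step replaces the energy `e` by at most `(1 - β * #B) * e + β` (`sum_conv_sq_le`).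
For `B` a cube with about `2 / e` points this is a decrease by a relative amount of order `V ^ α * e
^ (α / d)`, hence `e ^ (-α / d)` grows at least linearly in `n` until `e` falls to the order of `1 /
N`. Splitting time in two halves turns the energy bound into a pointwise one (`exists_convPow_le`).

Off the diagonal, put `T = n * V ^ α` and `m = max |x| V`. When `T ≥ m ^ α` the on-diagonal bound
suffices. Otherwise jumps longer than `ρ = m / k` are removed. Restoring them costs at most `n`
times the largest removed value, which is of order `T * m ^ (-d - α)` (`convPow_le_truncated_add`).
The truncated walk must make half of the displacement in some coordinate during one half of the
time; a Chernoff bound with weight `cosh` gives this probability order `(T / m ^ α) ^ (1 + d / α)`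
(`sum_convPow_tail_le`). The other half of the time contributes the on-diagonal bound, and the
product is at most of order `T * m ^ (-d - α) + 1 / N` (`profile_mul_le`). -/

open Finset

namespace CirculantWalk

/-! ### Convolution powers on a finite abelian group. -/

section ConvolutionPower

variable {G : Type*} [AddCommGroup G] [Fintype G]

theorem sum_sub_left_eq (g : G → ℝ) (x : G) : ∑ y, g (x - y) = ∑ y, g y :=
  (Equiv.subLeft x).sum_comp g

theorem sum_sub_right_eq (g : G → ℝ) (y : G) : ∑ x, g (x - y) = ∑ x, g x :=
  (Equiv.subRight y).sum_comp g

variable [DecidableEq G]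

/-- The `n`-fold convolution power of a function on a finite abelian group. -/
def convPow (p : G → ℝ) : ℕ → G → ℝ
  | 0 => fun x => if x = 0 then 1 else 0
  | n + 1 => fun x => ∑ y, p y * convPow p n (x - y)

theorem convPow_nonneg {p : G → ℝ} (hp : ∀ x, 0 ≤ p x) (n : ℕ) (x : G) : 0 ≤ convPow p n x := by
  induction n generalizing x with
  | zero => simp only [convPow]; split_ifs <;> norm_num
  | succ n ih => exact sum_nonneg fun y _ => mul_nonneg (hp y) (ih _)

theorem sum_convPow (p : G → ℝ) (n : ℕ) : ∑ x, convPow p n x = (∑ x, p x) ^ n := by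
  induction n with
  | zero => simp [convPow]
  | succ n ih =>
    simp only [convPow]
    rw [sum_comm]
    simp_rw [← mul_sum, sum_sub_right_eq, ih]
    rw [← sum_mul, pow_succ, mul_comm]

theorem convPow_mono {a p : G → ℝ} (ha : ∀ x, 0 ≤ a x) (hap : ∀ x, a x ≤ p x) (n : ℕ) (x : G) :
    convPow a n x ≤ convPow p n x := by
  induction n generalizing x with
  | zero => exact le_rfl
  | succ n ih =>
    exact sum_le_sum fun y _ => mul_le_mul (hap y) (ih _) (convPow_nonneg ha _ _)
      ((ha y).trans (hap y))

theorem convPow_one (p : G → ℝ) (x : G) : convPow p 1 x = p x := by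
  simp only [convPow]
  rw [sum_eq_single x]
  · simp
  · intro y _ hy
    rw [if_neg (sub_ne_zero.2 hy.symm), mul_zero]
  · simp

theorem convPow_add (p : G → ℝ) (m n : ℕ) (x : G) :
    convPow p (m + n) x = ∑ y, convPow p m y * convPow p n (x - y) := by
  induction m generalizing x with
  | zero => simp [convPow]
  | succ m ih =>
    rw [Nat.add_right_comm]
    simp only [convPow]
    simp_rw [ih, sum_mul, mul_sum]
    rw [sum_comm]
    conv_rhs => rw [sum_comm]
    rw [sum_comm]
    refine sum_congr rfl fun z _ => ?_
    rw [← (Equiv.subRight z).sum_comp]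
    refine sum_congr rfl fun y _ => ?_
    simp only [Equiv.subRight_apply]
    rw [sub_sub, add_sub_cancel, mul_assoc]

/-- Convolving with a probability law averages, so a sup bound on one step survives at all later
times. -/
theorem convPow_succ_le_of_forall_le {p : G → ℝ} (hp : ∀ x, 0 ≤ p x) (hp1 : ∑ x, p x = 1) {M : ℝ}
    (hM : ∀ x, p x ≤ M) (n : ℕ) (x : G) : convPow p (n + 1) x ≤ M := by
  simp only [convPow]
  calc ∑ y, p y * convPow p n (x - y) ≤ ∑ y, M * convPow p n (x - y) :=
        sum_le_sum fun y _ => mul_le_mul_of_nonneg_right (hM y) (convPow_nonneg hp _ _)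
    _ = M := by rw [← mul_sum, sum_sub_left_eq, sum_convPow, hp1, one_pow, mul_one]

/-- Two-step splitting and the Cauchy-Schwarz inequality. -/
theorem convPow_add_le (p : G → ℝ) (m n : ℕ) (x : G) :
    convPow p (m + n) x ≤ (∑ y, convPow p m y ^ 2 + ∑ y, convPow p n y ^ 2) / 2 := by
  rw [convPow_add, ← sum_sub_left_eq (fun y => convPow p n y ^ 2) x, ← sum_add_distrib, sum_div]
  refine sum_le_sum fun y _ => ?_
  nlinarith [sq_nonneg (convPow p m y - convPow p n (x - y))]

/-- One convolution step contracts the `ℓ²` norm as soon as the kernel is bounded below on a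
finite set. -/
theorem sum_conv_sq_le {p μ : G → ℝ} (hp1 : ∑ x, p x = 1)
    (hμ : ∀ x, 0 ≤ μ x) (hμ1 : ∑ x, μ x = 1) {B : Finset G} (hB : B.Nonempty) {β : ℝ}
    (hβ : 0 ≤ β) (hpB : ∀ x ∈ B, β ≤ p x) (hp : ∀ x, 0 ≤ p x) :
    ∑ x, (∑ y, p y * μ (x - y)) ^ 2 ≤ (1 - β * #B) * ∑ x, μ x ^ 2 + β := by
  have hk : (0 : ℝ) < #B := by exact_mod_cast hB.card_pos
  -- Removing the mass `β` on `B` leaves a nonnegative weight; the `q`-weighted squared deviation of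
  -- `μ (x - ·)` from its `p`-mean `m` is then nonnegative, and expanding it bounds `m ^ 2`.
  set q : G → ℝ := fun y => p y - if y ∈ B then β else 0 with hq
  have hq0 : ∀ y, 0 ≤ q y := by
    intro y
    simp only [hq]
    split_ifs with h
    · linarith [hpB y h]
    · simpa using hp y
  have hqs : ∀ g : G → ℝ, ∑ y, q y * g y = ∑ y, p y * g y - β * ∑ y ∈ B, g y := by
    intro g
    simp only [hq, sub_mul, sum_sub_distrib, ite_mul, zero_mul]
    rw [sum_ite_mem, univ_inter, mul_sum]
  have key : ∀ x, (∑ y, p y * μ (x - y)) ^ 2 ≤ ∑ y, p y * μ (x - y) ^ 2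
      - β * ∑ y ∈ B, μ (x - y) ^ 2 + β / #B * ∑ y ∈ B, μ (x - y) := by
    intro x
    set m := ∑ y, p y * μ (x - y) with hm
    set s := ∑ y ∈ B, μ (x - y) with hs
    have hs0 : 0 ≤ s := sum_nonneg fun y _ => hμ _
    have hs1 : s ≤ 1 := by
      rw [← hμ1, ← sum_sub_left_eq μ x]
      exact sum_le_univ_sum_of_nonneg fun y => hμ _
    have h0 : 0 ≤ ∑ y, q y * (μ (x - y) - m) ^ 2 :=
      sum_nonneg fun y _ => mul_nonneg (hq0 y) (sq_nonneg _)
    have h1 : ∑ y, q y * (μ (x - y) - m) ^ 2 = ∑ y, q y * μ (x - y) ^ 2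
        - 2 * m * ∑ y, q y * μ (x - y) + m ^ 2 * ∑ y, q y * 1 := by
      clear_value m
      rw [mul_sum, mul_sum, ← sum_sub_distrib, ← sum_add_distrib]
      exact sum_congr rfl fun y _ => by ring
    rw [h1, hqs (fun y => μ (x - y) ^ 2), hqs (fun y => μ (x - y)), hqs (fun _ => 1)] at h0
    simp only [mul_one, sum_const, nsmul_eq_mul, hp1, ← hm, ← hs] at h0
    -- Completing the square bounds the left side by `s ^ 2 / #B`, and `s ≤ 1`.
    have h2 : 2 * m * s - #B * m ^ 2 ≤ s / #B := by
      rw [le_div_iff₀ hk]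
      nlinarith [sq_nonneg (#B * m - s)]
    have h3 := mul_le_mul_of_nonneg_left h2 hβ
    have h4 : β / #B * s = β * (s / #B) := by ring
    rw [h4]
    nlinarith
  refine (sum_le_sum fun x _ => key x).trans (le_of_eq ?_)
  rw [sum_add_distrib, sum_sub_distrib, ← mul_sum, ← mul_sum, sum_comm,
    sum_comm (s := univ) (t := B), sum_comm (s := univ) (t := B)]
  simp_rw [← mul_sum, sum_sub_right_eq (fun x => μ x ^ 2), sum_sub_right_eq μ, hμ1]
  rw [← sum_mul, hp1]
  simp only [sum_const, nsmul_eq_mul]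
  field_simp

/-- Comparison of the convolution powers of a kernel and of a truncation of it: the difference
comes from the times at which a removed jump is made. -/
theorem convPow_le_truncated_add {a p : G → ℝ} (ha : ∀ x, 0 ≤ a x) (hap : ∀ x, a x ≤ p x)
    (hp1 : ∑ x, p x = 1) {β : ℝ} (hβ0 : 0 ≤ β) (hβ : ∀ x, p x - a x ≤ β) (n : ℕ) (x : G) :
    convPow p n x ≤ convPow a n x + n * β := by
  induction n generalizing x with
  | zero => simp [convPow]
  | succ n ih =>
    have hp : ∀ x, 0 ≤ p x := fun x => (ha x).trans (hap x)
    simp only [convPow]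
    have h1 : ∀ y, p y * convPow p n (x - y) ≤
        a y * convPow a n (x - y) + a y * (n * β) + β * convPow p n (x - y) := by
      intro y
      nlinarith [mul_le_mul_of_nonneg_left (ih (x - y)) (ha y),
        mul_le_mul_of_nonneg_right (hβ y) (convPow_nonneg hp n (x - y))]
    refine (sum_le_sum fun y _ => h1 y).trans ?_
    rw [sum_add_distrib, sum_add_distrib, ← sum_mul, ← mul_sum, sum_sub_left_eq, sum_convPow, hp1,
      one_pow]
    have h2 : ∑ y, a y ≤ 1 := hp1 ▸ sum_le_sum fun y _ => hap y
    have h3 : (∑ y, a y) * (n * β) ≤ 1 * (n * β) :=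
      mul_le_mul_of_nonneg_right h2 (by positivity)
    push_cast
    linarith

/-- Multiplicative moments of convolution powers for a weight which is submultiplicative on
average. -/
theorem sum_convPow_mul_le {a w : G → ℝ} (ha : ∀ x, 0 ≤ a x) {M : ℝ} (hM : 0 ≤ M)
    (hw0 : w 0 = 1) (hw : ∀ x, ∑ y, a y * w (y + x) ≤ M * w x) (n : ℕ) :
    ∑ x, convPow a n x * w x ≤ M ^ n := by
  induction n with
  | zero => simp [convPow, hw0]
  | succ n ih =>
    calc ∑ x, convPow a (n + 1) x * w x
        = ∑ y, ∑ x, a y * convPow a n (x - y) * w x := by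
          simp only [convPow, sum_mul]
          exact sum_comm
      _ = ∑ y, ∑ x, a y * convPow a n x * w (y + x) := by
          refine sum_congr rfl fun y _ => ?_
          rw [← Equiv.sum_comp (Equiv.addLeft y) fun x => a y * convPow a n (x - y) * w x]
          simp
      _ = ∑ x, convPow a n x * ∑ y, a y * w (y + x) := by
          rw [sum_comm]
          refine sum_congr rfl fun x _ => ?_
          rw [mul_sum]
          exact sum_congr rfl fun y _ => by ring
      _ ≤ ∑ x, convPow a n x * (M * w x) :=
          sum_le_sum fun x _ => mul_le_mul_of_nonneg_left (hw x) (convPow_nonneg ha _ _)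
      _ = M * ∑ x, convPow a n x * w x := by
          rw [mul_sum]
          exact sum_congr rfl fun y _ => by ring
      _ ≤ M ^ (n + 1) := by
          rw [pow_succ']
          exact mul_le_mul_of_nonneg_left ih hM

end ConvolutionPower

/-! ### The sup norm on the torus, cubes and dyadic sums. -/

section BoxNorm

variable {d L : ℕ}

/-- The `ℓ^∞` norm of the canonical representative of a point of the torus. -/
def boxNorm (x : Torus d L) : ℝ := ‖fun i => ((x i).valMinAbs : ℝ)‖

theorem boxNorm_nonneg (x : Torus d L) : 0 ≤ boxNorm x := norm_nonneg _

theorem abs_valMinAbs_le_boxNorm (x : Torus d L) (i : Fin d) :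
    |((x i).valMinAbs : ℝ)| ≤ boxNorm x :=
  norm_le_pi_norm (fun i => ((x i).valMinAbs : ℝ)) i

theorem boxNorm_le_iff {x : Torus d L} {r : ℝ} (hr : 0 ≤ r) :
    boxNorm x ≤ r ↔ ∀ i, |((x i).valMinAbs : ℝ)| ≤ r :=
  pi_norm_le_iff_of_nonneg hr

theorem exists_boxNorm_eq (hd : 1 ≤ d) (x : Torus d L) :
    ∃ i, boxNorm x = |((x i).valMinAbs : ℝ)| := by
  have : Nonempty (Fin d) := ⟨⟨0, hd⟩⟩
  obtain ⟨i, hi⟩ := Finite.exists_max fun i => |((x i).valMinAbs : ℝ)|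
  exact ⟨i, le_antisymm ((boxNorm_le_iff (abs_nonneg _)).2 hi) (abs_valMinAbs_le_boxNorm x i)⟩

theorem boxNorm_zero : boxNorm (0 : Torus d L) = 0 :=
  le_antisymm ((boxNorm_le_iff le_rfl).2 fun i => by simp) (boxNorm_nonneg _)

theorem one_le_boxNorm {x : Torus d L} (hx : x ≠ 0) : 1 ≤ boxNorm x := by
  obtain ⟨i, hi⟩ := Function.ne_iff.1 hx
  refine le_trans ?_ (abs_valMinAbs_le_boxNorm x i)
  have h : (x i).valMinAbs ≠ 0 := by simpa [ZMod.valMinAbs_eq_zero] using hi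
  exact_mod_cast Int.one_le_abs h

theorem abs_valMinAbs_le_half [NeZero L] (a : ZMod L) : |(a.valMinAbs : ℝ)| ≤ (L : ℝ) / 2 := by
  have h := ZMod.natAbs_valMinAbs_le a
  have h2 : (a.valMinAbs.natAbs : ℝ) ≤ ((L / 2 : ℕ) : ℝ) := by exact_mod_cast h
  rw [Nat.cast_natAbs, Int.cast_abs] at h2
  exact h2.trans Nat.cast_div_le

theorem boxNorm_le_half [NeZero L] (x : Torus d L) : boxNorm x ≤ (L : ℝ) / 2 :=
  (boxNorm_le_iff (by positivity)).2 fun i => abs_valMinAbs_le_half _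

theorem boxNorm_le_torusNorm (x : Torus d L) : boxNorm x ≤ torusNorm x :=
  (boxNorm_le_iff (norm_nonneg _)).2 fun i => by
    simpa [torusNorm, rep] using PiLp.norm_apply_le (rep x) i

theorem torusNorm_le_sqrt_mul_boxNorm (x : Torus d L) : torusNorm x ≤ √d * boxNorm x := by
  rw [torusNorm, EuclideanSpace.norm_eq]
  refine Real.sqrt_le_iff.2 ⟨mul_nonneg (Real.sqrt_nonneg _) (boxNorm_nonneg _), ?_⟩
  rw [mul_pow, Real.sq_sqrt (Nat.cast_nonneg d)]
  calc ∑ i, ‖rep x i‖ ^ 2 ≤ ∑ _i : Fin d, boxNorm x ^ 2 :=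
        sum_le_sum fun i _ => pow_le_pow_left₀ (norm_nonneg _) (abs_valMinAbs_le_boxNorm x i) 2
    _ = d * boxNorm x ^ 2 := by simp

theorem card_boxNorm_le [NeZero L] {r : ℝ} (hr : 1 ≤ r) :
    (#{x : Torus d L | boxNorm x ≤ r} : ℝ) ≤ (3 * r) ^ d := by
  have h : #{x : Torus d L | boxNorm x ≤ r} ≤
      #(Fintype.piFinset fun _ : Fin d => Icc (-⌊r⌋) ⌊r⌋) := by
    refine card_le_card_of_injOn (fun x i => (x i).valMinAbs) ?_ ?_
    · intro x hx
      simp only [coe_filter, mem_univ, true_and, Set.mem_ofPred_eq,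
        boxNorm_le_iff (zero_le_one.trans hr)] at hx
      simp only [mem_coe, Fintype.mem_piFinset, mem_Icc]
      intro i
      have := abs_le.1 (hx i)
      refine ⟨?_, Int.le_floor.2 this.2⟩
      rw [neg_le, Int.le_floor]
      push_cast
      linarith
    · intro x _ y _ hxy
      funext i
      exact ZMod.injective_valMinAbs (congrFun hxy i)
  have h0 : 1 ≤ ⌊r⌋ := Int.le_floor.2 (by simpa using hr)
  rw [Fintype.card_piFinset_const, Int.card_Icc] at h
  have h1 : (((⌊r⌋ + 1 - -⌊r⌋).toNat : ℕ) : ℝ) ≤ 3 * r := by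
    have h2 : (((⌊r⌋ + 1 - -⌊r⌋).toNat : ℕ) : ℤ) = 2 * ⌊r⌋ + 1 := by
      rw [Int.toNat_of_nonneg (by lia)]; ring
    have h3 : (((⌊r⌋ + 1 - -⌊r⌋).toNat : ℕ) : ℝ) = 2 * (⌊r⌋ : ℝ) + 1 := by exact_mod_cast h2
    rw [h3]
    linarith [Int.floor_le r]
  calc (#{x : Torus d L | boxNorm x ≤ r} : ℝ)
      ≤ (((⌊r⌋ + 1 - -⌊r⌋).toNat : ℕ) : ℝ) ^ d := by exact_mod_cast h
    _ ≤ (3 * r) ^ d := pow_le_pow_left₀ (Nat.cast_nonneg _) h1 d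

theorem abs_valMinAbs_le_val [NeZero L] (a : ZMod L) : |(a.valMinAbs : ℝ)| ≤ (a.val : ℝ) := by
  have h : a.valMinAbs.natAbs ≤ a.val := by
    rw [ZMod.valMinAbs_natAbs_eq_min]
    exact min_le_left _ _
  rw [← Int.cast_abs, ← Nat.cast_natAbs]
  exact_mod_cast h

/-- The cube `{0, …, R}^d` without the origin, where the kernel has no lower bound. A one-sided cube
has distinct points for every `R < L`, and for `d ≥ 1` it keeps `(R + 1) ^ d - 1 ≥ R ^ d` of them.
-/
theorem exists_box [NeZero L] (hd : 1 ≤ d) {R : ℕ} (hRL : R < L) :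
    ∃ B : Finset (Torus d L), (∀ x ∈ B, x ≠ 0 ∧ boxNorm x ≤ R) ∧ (R : ℝ) ^ d ≤ #B := by
  refine ⟨(Fintype.piFinset fun _ : Fin d => (range (R + 1)).image fun k : ℕ => (k : ZMod L)).erase 0,
    ?_, ?_⟩
  · intro x hx
    rw [mem_erase, Fintype.mem_piFinset] at hx
    refine ⟨hx.1, (boxNorm_le_iff (Nat.cast_nonneg R)).2 fun i => ?_⟩
    obtain ⟨k, hk, hkx⟩ := mem_image.1 (hx.2 i)
    rw [mem_range] at hk
    refine (abs_valMinAbs_le_val (x i)).trans ?_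
    rw [← hkx, ZMod.val_natCast_of_lt (by lia)]
    exact_mod_cast Nat.lt_succ_iff.1 hk
  · have h1 : #((range (R + 1)).image fun k : ℕ => (k : ZMod L)) = R + 1 := by
      rw [card_image_of_injOn, card_range]
      intro a ha b hb hab
      simp only [coe_range, Set.mem_Iio] at ha hb
      have := congrArg ZMod.val hab
      simp only at this
      rwa [ZMod.val_natCast_of_lt (by lia), ZMod.val_natCast_of_lt (by lia)] at this
    have h2 : (0 : Torus d L) ∈
        Fintype.piFinset fun _ : Fin d => (range (R + 1)).image fun k : ℕ => (k : ZMod L) := by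
      rw [Fintype.mem_piFinset]
      intro i
      exact mem_image.2 ⟨0, by simp, by simp⟩
    rw [card_erase_of_mem h2, Fintype.card_piFinset_const, h1]
    have h3 : R ^ d < (R + 1) ^ d := Nat.pow_lt_pow_left (by lia) (by lia)
    exact_mod_cast Nat.le_sub_one_of_lt h3

/-- Truncated second moment of a stable-like kernel, by summation over dyadic shells. -/
theorem exists_sum_boxNorm_sq_le (d : ℕ) {α : ℝ} (hα : α ∈ Set.Ioo (0 : ℝ) 2) :
    ∃ K : ℝ, 0 < K ∧ ∀ (L : ℕ) [NeZero L] (r : ℝ), 0 ≤ r →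
      ∑ x : Torus d L with boxNorm x ≤ r, boxNorm x ^ 2 * boxNorm x ^ (-(d : ℝ) - α) ≤
        K * r ^ (2 - α) := by
  set θ : ℝ := (1 / 2 : ℝ) ^ (2 - α) with hθ
  have hθ1 : θ < 1 := Real.rpow_lt_one (by norm_num) (by norm_num) (by linarith [hα.2])
  set A : ℝ := 3 ^ d * 2 ^ ((d : ℝ) + α) with hA
  have hA0 : 0 < A := by positivity
  have hK0 : 0 < A / (1 - θ) := div_pos hA0 (by linarith)
  -- The constant solves `K = θ * K + A`: halving the radius multiplies `r ^ (2 - α)` by `θ < 1`, as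
  -- `α < 2`, and the outer shell costs `A * r ^ (2 - α)`.
  refine ⟨A / (1 - θ), hK0, fun L _ => ?_⟩
  have main : ∀ j : ℕ, ∀ r : ℝ, 0 ≤ r → r < 2 ^ j →
      ∑ x : Torus d L with boxNorm x ≤ r, boxNorm x ^ 2 * boxNorm x ^ (-(d : ℝ) - α) ≤
        A / (1 - θ) * r ^ (2 - α) := by
    have small : ∀ r : ℝ, 0 ≤ r → r < 1 →
        ∑ x : Torus d L with boxNorm x ≤ r, boxNorm x ^ 2 * boxNorm x ^ (-(d : ℝ) - α) ≤
          A / (1 - θ) * r ^ (2 - α) := by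
      intro r hr0 hr
      refine le_trans (le_of_eq (sum_eq_zero fun x hx => ?_))
        (mul_nonneg hK0.le (Real.rpow_nonneg hr0 _))
      have hx0 : x = 0 := by
        by_contra h
        linarith [one_le_boxNorm h, (mem_filter.1 hx).2]
      rw [hx0, boxNorm_zero]
      simp
    intro j
    induction j with
    | zero => intro r hr0 hr; exact small r hr0 (by simpa using hr)
    | succ j ih =>
      intro r hr0 hr
      rcases lt_or_ge r 1 with h1 | h1
      · exact small r hr0 h1
      have hrp : 0 < r := by linarith
      have hI := ih (r / 2) (by positivity) (by rw [pow_succ] at hr; linarith)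
      have hsub : (univ.filter fun x : Torus d L => boxNorm x ≤ r) =
          (univ.filter fun x : Torus d L => boxNorm x ≤ r / 2) ∪
          (univ.filter fun x : Torus d L => r / 2 < boxNorm x ∧ boxNorm x ≤ r) := by
        ext x
        simp only [mem_filter, mem_univ, true_and, mem_union]
        constructor
        · intro h
          rcases le_or_gt (boxNorm x) (r / 2) with h' | h'
          · exact Or.inl h'
          · exact Or.inr ⟨h', h⟩
        · rintro (h | h)
          · linarith
          · exact h.2
      have hdis : Disjoint (univ.filter fun x : Torus d L => boxNorm x ≤ r / 2)
          (univ.filter fun x : Torus d L => r / 2 < boxNorm x ∧ boxNorm x ≤ r) := by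
        rw [disjoint_filter]
        intro x _ h h'
        linarith [h'.1]
      rw [hsub, sum_union hdis]
      have hshell : ∑ x : Torus d L with r / 2 < boxNorm x ∧ boxNorm x ≤ r,
          boxNorm x ^ 2 * boxNorm x ^ (-(d : ℝ) - α) ≤ A * r ^ (2 - α) := by
        calc ∑ x : Torus d L with r / 2 < boxNorm x ∧ boxNorm x ≤ r,
              boxNorm x ^ 2 * boxNorm x ^ (-(d : ℝ) - α)
            ≤ ∑ x : Torus d L with r / 2 < boxNorm x ∧ boxNorm x ≤ r,
              r ^ 2 * (r / 2) ^ (-(d : ℝ) - α) := by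
              refine sum_le_sum fun x hx => ?_
              obtain ⟨h2, h3⟩ := (mem_filter.1 hx).2
              exact mul_le_mul (pow_le_pow_left₀ (boxNorm_nonneg x) h3 2)
                (Real.rpow_le_rpow_of_nonpos (by positivity) h2.le
                  (by linarith [hα.1, Nat.cast_nonneg (α := ℝ) d]))
                (Real.rpow_nonneg (boxNorm_nonneg x) _) (by positivity)
          _ = #{x : Torus d L | r / 2 < boxNorm x ∧ boxNorm x ≤ r} *
              (r ^ 2 * (r / 2) ^ (-(d : ℝ) - α)) := by rw [sum_const, nsmul_eq_mul]
          _ ≤ (3 * r) ^ d * (r ^ 2 * (r / 2) ^ (-(d : ℝ) - α)) := by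
              refine mul_le_mul_of_nonneg_right ((Nat.cast_le.2 (card_le_card ?_)).trans
                (card_boxNorm_le (L := L) h1)) (by positivity)
              exact monotone_filter_right _ fun x _ h => h.2
          _ = A * r ^ (2 - α) := by
              rw [hA, Real.div_rpow hrp.le two_pos.le, mul_pow, ← Real.rpow_natCast r d,
                ← Real.rpow_natCast r 2]
              have e1 : r ^ (2 - α) = r ^ (d : ℝ) * (r ^ ((2 : ℕ) : ℝ) * r ^ (-(d : ℝ) - α)) := by
                rw [← Real.rpow_add hrp, ← Real.rpow_add hrp]
                congr 1
                push_cast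
                ring
              have e2 : (2 : ℝ) ^ ((d : ℝ) + α) = (2 ^ (-(d : ℝ) - α))⁻¹ := by
                rw [← Real.rpow_neg two_pos.le]
                congr 1
                ring
              rw [e1, e2]
              ring
      have hhalf : (r / 2) ^ (2 - α) = θ * r ^ (2 - α) := by
        rw [hθ, ← Real.mul_rpow (by norm_num) hrp.le]
        congr 1
        ring
      rw [hhalf] at hI
      have hne : (1 - θ) ≠ 0 := by linarith
      calc _ ≤ A / (1 - θ) * (θ * r ^ (2 - α)) + A * r ^ (2 - α) := add_le_add hI hshell
        _ = A / (1 - θ) * r ^ (2 - α) := by field_simp; ring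
  intro r hr
  obtain ⟨j, hj⟩ := pow_unbounded_of_one_lt r one_lt_two
  exact main j r hr hj

/-- Tail sum of a stable-like kernel, by summation over dyadic shells. -/
theorem exists_sum_tail_le (d : ℕ) {α : ℝ} (hα : α ∈ Set.Ioo (0 : ℝ) 2) :
    ∃ K : ℝ, 0 < K ∧ ∀ (L : ℕ) [NeZero L] (r : ℝ), 1 ≤ r →
      ∑ x : Torus d L with r < boxNorm x, boxNorm x ^ (-(d : ℝ) - α) ≤ K * r ^ (-α) := by
  set θ : ℝ := (2 : ℝ) ^ (-α) with hθ
  have hθ1 : θ < 1 := Real.rpow_lt_one_of_one_lt_of_neg one_lt_two (by linarith [hα.1])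
  set A : ℝ := 6 ^ d with hA
  have hA0 : 0 < A := by positivity
  have hK0 : 0 < A / (1 - θ) := div_pos hA0 (by linarith)
  refine ⟨A / (1 - θ), hK0, fun L _ => ?_⟩
  -- Here the radius is doubled until it exceeds the torus, where the tail is empty; the geometric
  -- ratio is below one because `α > 0`.
  have main : ∀ j : ℕ, ∀ r : ℝ, 1 ≤ r → (L : ℝ) < r * 2 ^ j →
      ∑ x : Torus d L with r < boxNorm x, boxNorm x ^ (-(d : ℝ) - α) ≤
        A / (1 - θ) * r ^ (-α) := by
    intro j
    induction j with
    | zero =>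
      intro r hr0 hr
      rw [filter_false_of_mem, sum_empty]
      · exact mul_nonneg hK0.le (Real.rpow_nonneg (by linarith) _)
      · intro x _ h
        have := boxNorm_le_half x
        have hL : (0 : ℝ) ≤ L := Nat.cast_nonneg L
        rw [pow_zero, mul_one] at hr
        linarith
    | succ j ih =>
      intro r h1 hr
      have hrp : 0 < r := by linarith
      have hI := ih (2 * r) (by linarith) (by rw [pow_succ] at hr; linarith)
      have hsub : (univ.filter fun x : Torus d L => r < boxNorm x) =
          (univ.filter fun x : Torus d L => 2 * r < boxNorm x) ∪
          (univ.filter fun x : Torus d L => r < boxNorm x ∧ boxNorm x ≤ 2 * r) := by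
        ext x
        simp only [mem_filter, mem_univ, true_and, mem_union]
        constructor
        · intro h
          rcases lt_or_ge (2 * r) (boxNorm x) with h' | h'
          · exact Or.inl h'
          · exact Or.inr ⟨h, h'⟩
        · rintro (h | h)
          · linarith
          · exact h.1
      have hdis : Disjoint (univ.filter fun x : Torus d L => 2 * r < boxNorm x)
          (univ.filter fun x : Torus d L => r < boxNorm x ∧ boxNorm x ≤ 2 * r) := by
        rw [disjoint_filter]
        intro x _ h h'
        linarith [h'.2]
      rw [hsub, sum_union hdis]
      have hshell : ∑ x : Torus d L with r < boxNorm x ∧ boxNorm x ≤ 2 * r,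
          boxNorm x ^ (-(d : ℝ) - α) ≤ A * r ^ (-α) := by
        calc ∑ x : Torus d L with r < boxNorm x ∧ boxNorm x ≤ 2 * r, boxNorm x ^ (-(d : ℝ) - α)
            ≤ ∑ x : Torus d L with r < boxNorm x ∧ boxNorm x ≤ 2 * r, r ^ (-(d : ℝ) - α) := by
              refine sum_le_sum fun x hx => ?_
              exact Real.rpow_le_rpow_of_nonpos hrp (mem_filter.1 hx).2.1.le
                  (by linarith [hα.1, Nat.cast_nonneg (α := ℝ) d])
          _ = #{x : Torus d L | r < boxNorm x ∧ boxNorm x ≤ 2 * r} * r ^ (-(d : ℝ) - α) := by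
              rw [sum_const, nsmul_eq_mul]
          _ ≤ (3 * (2 * r)) ^ d * r ^ (-(d : ℝ) - α) := by
              refine mul_le_mul_of_nonneg_right ((Nat.cast_le.2 (card_le_card ?_)).trans
                (card_boxNorm_le (L := L) (by linarith : 1 ≤ 2 * r))) (by positivity)
              exact monotone_filter_right _ fun x _ h => h.2
          _ = A * r ^ (-α) := by
              have e1 : r ^ (-α) = r ^ (d : ℝ) * r ^ (-(d : ℝ) - α) := by
                rw [← Real.rpow_add hrp]
                congr 1
                ring
              rw [hA, e1, Real.rpow_natCast, ← mul_assoc, ← mul_assoc, mul_pow]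
              norm_num
      have hdouble : (2 * r) ^ (-α) = θ * r ^ (-α) := by
        rw [hθ, ← Real.mul_rpow (by norm_num) hrp.le]
      rw [hdouble] at hI
      have hne : (1 - θ) ≠ 0 := by linarith
      calc _ ≤ A / (1 - θ) * (θ * r ^ (-α)) + A * r ^ (-α) := add_le_add hI hshell
        _ = A / (1 - θ) * r ^ (-α) := by field_simp; ring
  intro r hr
  obtain ⟨j, hj⟩ := pow_unbounded_of_one_lt (L : ℝ) one_lt_two
  refine main j r hr (hj.trans_le ?_)
  nlinarith [pow_pos (two_pos (α := ℝ)) j]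

end BoxNorm

/-! ### Stable-like kernels. -/

/-- A transition kernel on the torus which is comparable, off the origin, with the `α`-stable
profile at scale `V`. -/
structure IsStableKernel {d L : ℕ} [NeZero L] (p : Torus d L → ℝ) (α V c₁ c₂ : ℝ) : Prop where
  nonneg : ∀ x, 0 ≤ p x
  sum_eq_one : ∑ x, p x = 1
  lower : ∀ x, x ≠ 0 → c₁ * (V ^ α * max (boxNorm x) V ^ (-(d : ℝ) - α)) ≤ p x
  upper : ∀ x, p x ≤ c₂ * (V ^ α * max (boxNorm x) V ^ (-(d : ℝ) - α))
  -- A coordinate equal to `L / 2` is its own negative on the torus, so symmetry of `f` says nothing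
  -- there; only points off this face are required to be symmetric.
  symm : ∀ x : Torus d L, (∀ i, 2 * |((x i).valMinAbs : ℝ)| < L) → p (-x) = p x

/-! ### Energy decay and the on-diagonal bound. -/

section OnDiagonal

variable {d L : ℕ} {α V c₁ c₂ : ℝ}

/-- Comparison of the on-diagonal profile at comparable times. -/
theorem rpow_neg_le_of_le_three_mul (hα : 0 < α) (hV : 0 < V) {m n : ℕ} (hn : 1 ≤ n)
    (hnm : n ≤ 3 * m) : ((m : ℝ) * V ^ α) ^ (-((d : ℝ) / α)) ≤
      3 ^ ((d : ℝ) / α) * ((n : ℝ) * V ^ α) ^ (-((d : ℝ) / α)) := by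
  have hn0 : (0 : ℝ) < n := by exact_mod_cast hn
  have hnm' : (n : ℝ) ≤ 3 * m := by exact_mod_cast hnm
  have h2 : ((m : ℝ) * V ^ α) ^ (-((d : ℝ) / α)) ≤
      (3⁻¹ * ((n : ℝ) * V ^ α)) ^ (-((d : ℝ) / α)) := by
    refine Real.rpow_le_rpow_of_nonpos (by positivity) ?_ (neg_nonpos.2 (by positivity))
    rw [← mul_assoc]
    exact mul_le_mul_of_nonneg_right (by linarith) (by positivity)
  refine h2.trans (le_of_eq ?_)
  rw [Real.mul_rpow (by norm_num) (by positivity), Real.inv_rpow (by norm_num),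
    Real.rpow_neg (by norm_num), inv_inv]

variable [NeZero L] {p : Torus d L → ℝ}

theorem IsStableKernel.sum_convPow_eq_one (hp : IsStableKernel p α V c₁ c₂) (n : ℕ) :
    ∑ x, convPow p n x = 1 := by
  rw [sum_convPow, hp.sum_eq_one, one_pow]

theorem IsStableKernel.le_rpow_neg (hp : IsStableKernel p α V c₁ c₂) (hα : 0 < α) (hV : 1 ≤ V)
    (hc₂ : 0 < c₂) (x : Torus d L) : p x ≤ c₂ * V ^ (-(d : ℝ)) := by
  have hV0 : 0 < V := by linarith
  refine (hp.upper x).trans (mul_le_mul_of_nonneg_left ?_ hc₂.le)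
  calc V ^ α * max (boxNorm x) V ^ (-(d : ℝ) - α) ≤ V ^ α * V ^ (-(d : ℝ) - α) :=
        mul_le_mul_of_nonneg_left (Real.rpow_le_rpow_of_nonpos hV0 (le_max_right _ _)
          (by linarith [Nat.cast_nonneg (α := ℝ) d])) (Real.rpow_nonneg hV0.le _)
    _ = V ^ (-(d : ℝ)) := by
        rw [← Real.rpow_add hV0]
        congr 1
        ring

/-- The energy `∑ pₙ(x)²`. -/
def energy (p : Torus d L → ℝ) (n : ℕ) : ℝ := ∑ x, convPow p n x ^ 2

theorem IsStableKernel.energy_pos (hp : IsStableKernel p α V c₁ c₂) (n : ℕ) : 0 < energy p n := by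
  have h := hp.sum_convPow_eq_one n
  obtain ⟨x, _, hx⟩ := exists_ne_zero_of_sum_ne_zero (h.trans_ne one_ne_zero)
  exact sum_pos' (fun x _ => sq_nonneg _) ⟨x, mem_univ x, by positivity⟩

theorem IsStableKernel.energy_le (hp : IsStableKernel p α V c₁ c₂) {n : ℕ} {M : ℝ}
    (hM : ∀ x, convPow p n x ≤ M) : energy p n ≤ M := by
  calc energy p n ≤ ∑ x, M * convPow p n x := sum_le_sum fun x _ => by
        rw [sq]
        exact mul_le_mul_of_nonneg_right (hM x) (convPow_nonneg hp.nonneg n x)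
    _ = M := by rw [← mul_sum, hp.sum_convPow_eq_one, mul_one]

theorem IsStableKernel.energy_le_one (hp : IsStableKernel p α V c₁ c₂) (n : ℕ) :
    energy p n ≤ 1 := by
  refine hp.energy_le fun x => ?_
  rw [← hp.sum_convPow_eq_one n]
  exact single_le_sum (fun y _ => convPow_nonneg hp.nonneg n y) (mem_univ x)

theorem IsStableKernel.energy_succ_le_rpow (hp : IsStableKernel p α V c₁ c₂) (hα : 0 < α)
    (hV : 1 ≤ V) (hc₂ : 0 < c₂) (n : ℕ) : energy p (n + 1) ≤ c₂ * V ^ (-(d : ℝ)) :=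
  hp.energy_le fun x => convPow_succ_le_of_forall_le hp.nonneg hp.sum_eq_one
    (hp.le_rpow_neg hα hV hc₂) n x

theorem IsStableKernel.energy_succ_le_of_box (hp : IsStableKernel p α V c₁ c₂)
    {B : Finset (Torus d L)} (hB : B.Nonempty) {β : ℝ} (hβ : 0 ≤ β) (hpB : ∀ x ∈ B, β ≤ p x)
    (n : ℕ) : energy p (n + 1) ≤ (1 - β * #B) * energy p n + β :=
  sum_conv_sq_le hp.sum_eq_one (convPow_nonneg hp.nonneg n) (hp.sum_convPow_eq_one n) hB hβ hpB
    hp.nonneg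

theorem IsStableKernel.energy_succ_le (hp : IsStableKernel p α V c₁ c₂) (n : ℕ) :
    energy p (n + 1) ≤ energy p n := by
  -- With `β = 0` the contraction estimate is plain monotonicity.
  simpa using hp.energy_succ_le_of_box (B := {0}) (singleton_nonempty 0) le_rfl
    (fun x _ => hp.nonneg x) n

/-- The rate constant in the discrete Nash inequality. -/
noncomputable def nashConst (d : ℕ) (α c₁ c₂ : ℝ) : ℝ :=
  c₁ / 2 * (max 2 c₂) ^ (-(d : ℝ) - α) * 2 ^ (-(α / d))

theorem nashConst_pos (d : ℕ) (α : ℝ) (hc₁ : 0 < c₁) : 0 < nashConst d α c₁ c₂ := by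
  have : 0 < max 2 c₂ := lt_max_of_lt_left two_pos
  unfold nashConst
  positivity

/-- A discrete differential inequality of Nash type for the energy. -/
theorem IsStableKernel.energy_succ_le_nash (hp : IsStableKernel p α V c₁ c₂) (hd : 1 ≤ d)
    (hα : 0 < α) (hV : 1 ≤ V) (hc₁ : 0 < c₁) (hc₂ : 0 < c₂) {n : ℕ} (hn : 1 ≤ n)
    (hE : 2 * 2 ^ d / (L : ℝ) ^ d ≤ energy p n) (hL : 2 ≤ L) :
    energy p (n + 1) ≤
      energy p n * (1 - nashConst d α c₁ c₂ * V ^ α * energy p n ^ (α / d)) := by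
  set e := energy p n with he
  have he0 : 0 < e := hp.energy_pos n
  have he1 : e ≤ 1 := hp.energy_le_one n
  have hV0 : 0 < V := by linarith
  have hd0 : (0 : ℝ) < d := by exact_mod_cast hd
  have hL0 : (0 : ℝ) < L := by exact_mod_cast (by lia : 0 < L)
  have hL2 : (2 : ℝ) ≤ L := by exact_mod_cast hL
  have heV : e ≤ c₂ * V ^ (-(d : ℝ)) := by
    obtain ⟨k, rfl⟩ := Nat.exists_eq_add_of_le' hn
    exact hp.energy_succ_le_rpow hα hV hc₂ k
  -- The side is chosen so that the cube has at least `2 / e` points: the error `β` is then at most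
  -- half of the gain `β * #B * e`.
  set ρ : ℝ := (2 / e) ^ (1 / (d : ℝ)) with hρ
  have h2e : 0 < 2 / e := by positivity
  have h2e1 : 1 ≤ 2 / e := by rw [le_div_iff₀ he0]; linarith
  have hρ1 : 1 ≤ ρ := Real.one_le_rpow h2e1 (by positivity)
  have hρ0 : 0 < ρ := by linarith
  have hρd : ρ ^ d = 2 / e := by
    rw [hρ, ← Real.rpow_natCast, ← Real.rpow_mul h2e.le, one_div_mul_cancel hd0.ne', Real.rpow_one]
  have hdne : d ≠ 0 := by lia
  -- This is where the lower bound on the energy enters; it makes `⌈ρ⌉₊ < ρ + 1 ≤ L`, so the cube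
  -- fits in the torus.
  have hρL : ρ ≤ L / 2 := by
    refine le_of_pow_le_pow_left₀ hdne (by positivity) ?_
    rw [hρd, div_pow, div_le_div_iff₀ he0 (by positivity)]
    rw [div_le_iff₀ (by positivity)] at hE
    linarith
  set R := ⌈ρ⌉₊ with hR
  have hρR : ρ ≤ R := Nat.le_ceil ρ
  have hRρ : (R : ℝ) < ρ + 1 := Nat.ceil_lt_add_one hρ0.le
  have hRL : R < L := by
    have : (R : ℝ) < L := by linarith
    exact_mod_cast this
  obtain ⟨B, hB, hBc⟩ := exists_box (L := L) hd hRL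
  have hBc' : ρ ^ d ≤ #B := (pow_le_pow_left₀ hρ0.le hρR d).trans hBc
  have hB0 : (0 : ℝ) < #B := (pow_pos hρ0 d).trans_le hBc'
  have hBne : B.Nonempty := card_pos.1 (by exact_mod_cast hB0)
  -- The `2` absorbs the rounding `R < ρ + 1 ≤ 2 * ρ`; the `c₂` gives `V ≤ D * ρ` through the
  -- one-step bound `e ≤ c₂ * V ^ (-d)`.
  set D : ℝ := max 2 c₂ with hD
  have hD2 : 2 ≤ D := le_max_left _ _
  have hDc : c₂ ≤ D := le_max_right _ _
  have hD0 : 0 < D := by linarith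
  have hVD : V ≤ D * ρ := by
    refine le_of_pow_le_pow_left₀ hdne (by positivity) ?_
    rw [mul_pow, hρd]
    rw [Real.rpow_neg hV0.le, Real.rpow_natCast, ← div_eq_mul_inv, le_div_iff₀ (by positivity)] at heV
    have h1 : D ≤ D ^ d := le_self_pow₀ (by linarith) hdne
    rw [mul_div_assoc', le_div_iff₀ he0]
    nlinarith
  have hmax : ∀ x ∈ B, max (boxNorm x) V ≤ D * ρ := by
    intro x hx
    refine max_le ?_ hVD
    nlinarith [(hB x hx).2]
  have hexp : -(d : ℝ) - α ≤ 0 := by linarith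
  set β : ℝ := c₁ * (V ^ α * (D * ρ) ^ (-(d : ℝ) - α)) with hβ
  have hβ0 : 0 < β := by positivity
  have hpB : ∀ x ∈ B, β ≤ p x := by
    intro x hx
    refine le_trans ?_ (hp.lower x (hB x hx).1)
    exact mul_le_mul_of_nonneg_left (mul_le_mul_of_nonneg_left
      (Real.rpow_le_rpow_of_nonpos (hV0.trans_le (le_max_right _ _)) (hmax x hx) hexp)
      (Real.rpow_nonneg hV0.le _)) hc₁.le
  have hstep := hp.energy_succ_le_of_box hBne hβ0.le hpB n
  rw [← he] at hstep
  have hBe : 2 ≤ #B * e := by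
    rw [hρd, div_le_iff₀ he0] at hBc'
    exact hBc'
  have hcoef : nashConst d α c₁ c₂ * V ^ α * e ^ (α / d) = β * ρ ^ d / 2 := by
    have e1 : ρ ^ (-(d : ℝ) - α) * ρ ^ d = 2 ^ (-(α / d)) * e ^ (α / d) := by
      rw [← Real.rpow_natCast ρ d, ← Real.rpow_add hρ0, hρ, ← Real.rpow_mul h2e.le]
      rw [show 1 / (d : ℝ) * (-(d : ℝ) - α + d) = -(α / d) by ring,
        Real.div_rpow two_pos.le he0.le, Real.rpow_neg he0.le, div_inv_eq_mul]
    rw [hβ, Real.mul_rpow hD0.le hρ0.le, nashConst]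
    calc c₁ / 2 * max 2 c₂ ^ (-(d : ℝ) - α) * 2 ^ (-(α / d)) * V ^ α * e ^ (α / d)
        = c₁ / 2 * D ^ (-(d : ℝ) - α) * V ^ α * (2 ^ (-(α / d)) * e ^ (α / d)) := by
          rw [hD]; ring
      _ = _ := by rw [← e1]; ring
  rw [hcoef]
  have h3 : β * ρ ^ d * e ≤ β * #B * e := by gcongr
  have h4 : β * 2 ≤ β * (#B * e) := mul_le_mul_of_nonneg_left hBe hβ0.le
  nlinarith

/-- Decay of the energy. -/
theorem exists_energy_le (hd : 1 ≤ d) (hα : 0 < α) (hc₁ : 0 < c₁) (hc₂ : 0 < c₂) :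
    ∃ A : ℝ, 0 < A ∧ ∀ (L : ℕ) [NeZero L], 2 ≤ L → ∀ (V : ℝ), 1 ≤ V → ∀ p : Torus d L → ℝ,
      IsStableKernel p α V c₁ c₂ → ∀ n : ℕ, 1 ≤ n →
        energy p n ≤ A * (((n : ℝ) * V ^ α) ^ (-((d : ℝ) / α)) + 1 / (L : ℝ) ^ d) := by
  have hd0 : (0 : ℝ) < d := by exact_mod_cast hd
  set γ : ℝ := α / d with hγ
  have hγ0 : 0 < γ := by positivity
  -- The growth rate of `energy ^ (-γ)`: the first entry serves the induction step, the second the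
  -- case `n = 1`.
  set c := min (γ * nashConst d α c₁ c₂) (c₂ ^ (-γ)) with hc
  have hc0 : 0 < c := lt_min (mul_pos hγ0 (nashConst_pos d α hc₁)) (by positivity)
  set A₀ : ℝ := 2 * 2 ^ d with hA₀
  have hA₀0 : 0 < A₀ := by positivity
  refine ⟨max A₀ (c ^ (-((d : ℝ) / α))), lt_max_of_lt_left hA₀0, ?_⟩
  intro L _ hL V hV p hp n hn
  have hV0 : 0 < V := by linarith
  have hL0 : (0 : ℝ) < L := by exact_mod_cast (by lia : 0 < L)
  have main : energy p n ≤ A₀ / (L : ℝ) ^ d ∨ c * (n * V ^ α) ≤ energy p n ^ (-γ) := by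
    induction n, hn using Nat.le_induction with
    | base =>
      right
      have h1 := hp.energy_succ_le_rpow hα hV hc₂ 0
      have h2 := Real.rpow_le_rpow_of_nonpos (hp.energy_pos 1) h1 (neg_nonpos.2 hγ0.le)
      refine le_trans ?_ h2
      rw [Real.mul_rpow hc₂.le (by positivity), ← Real.rpow_mul hV0.le,
        show -(d : ℝ) * -γ = α by rw [hγ]; field_simp, Nat.cast_one, one_mul]
      exact mul_le_mul_of_nonneg_right (min_le_right _ _) (by positivity)
    | succ n hn ih =>
      rcases ih with h | h
      · exact Or.inl ((hp.energy_succ_le n).trans h)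
      rcases le_or_gt (A₀ / (L : ℝ) ^ d) (energy p n) with h' | h'
      · right
        have hs := hp.energy_succ_le_nash hd hα hV hc₁ hc₂ hn h' hL
        rw [← hγ] at hs
        set e := energy p n with he
        have he0 : 0 < e := hp.energy_pos n
        set s := nashConst d α c₁ c₂ * V ^ α * e ^ γ with hs'
        -- Using `1 - s ≤ exp (-s)` avoids any sign condition on `1 - s`. Raising to the power `-γ`
        -- gives the factor `exp (γ * s) ≥ 1 + γ * s`, and `e ^ (-γ) * γ * s` does not depend on
        -- `e`.
        have h1 : energy p (n + 1) ≤ e * Real.exp (-s) :=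
          hs.trans (mul_le_mul_of_nonneg_left (by linarith [Real.add_one_le_exp (-s)]) he0.le)
        have h2 := Real.rpow_le_rpow_of_nonpos (hp.energy_pos (n + 1)) h1 (neg_nonpos.2 hγ0.le)
        refine le_trans ?_ h2
        rw [Real.mul_rpow he0.le (Real.exp_pos _).le, ← Real.exp_mul]
        have h3 : 1 + γ * s ≤ Real.exp (-s * -γ) := by
          linarith [Real.add_one_le_exp (-s * -γ)]
        have h4 : e ^ (-γ) * (1 + γ * s) ≤ e ^ (-γ) * Real.exp (-s * -γ) :=
          mul_le_mul_of_nonneg_left h3 (by positivity)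
        refine le_trans ?_ h4
        have h5 : e ^ (-γ) * (1 + γ * s) = e ^ (-γ) + γ * nashConst d α c₁ c₂ * V ^ α := by
          have : e ^ (-γ) * e ^ γ = 1 := by
            rw [← Real.rpow_add he0, neg_add_cancel, Real.rpow_zero]
          rw [hs']
          linear_combination γ * nashConst d α c₁ c₂ * V ^ α * this
        rw [h5]
        have h6 : c * V ^ α ≤ γ * nashConst d α c₁ c₂ * V ^ α :=
          mul_le_mul_of_nonneg_right (min_le_left _ _) (by positivity)
        push_cast
        linarith
      · exact Or.inl ((hp.energy_succ_le n).trans h'.le)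
  have hn0 : (0 : ℝ) < n := by exact_mod_cast hn
  have hx : 0 < ((n : ℝ) * V ^ α) ^ (-((d : ℝ) / α)) := by positivity
  have hy : 0 < 1 / (L : ℝ) ^ d := by positivity
  rcases main with h | h
  · calc energy p n ≤ A₀ * (1 / (L : ℝ) ^ d) := by rw [mul_one_div]; exact h
      _ ≤ max A₀ (c ^ (-((d : ℝ) / α))) *
          (((n : ℝ) * V ^ α) ^ (-((d : ℝ) / α)) + 1 / (L : ℝ) ^ d) :=
        mul_le_mul (le_max_left _ _) (by linarith) hy.le (hA₀0.le.trans (le_max_left _ _))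
  · have he0 : 0 < energy p n := hp.energy_pos n
    have h1 := Real.rpow_le_rpow_of_nonpos (z := -((d : ℝ) / α)) (by positivity) h
      (neg_nonpos.2 (by positivity))
    rw [← Real.rpow_mul he0.le, show -γ * -((d : ℝ) / α) = 1 by rw [hγ]; field_simp,
      Real.rpow_one, Real.mul_rpow hc0.le (by positivity)] at h1
    exact h1.trans (mul_le_mul (le_max_right _ _) (by linarith) hx.le
      (hA₀0.le.trans (le_max_left _ _)))

/-- The uniform bound on the `n`-step transition probabilities. -/
theorem exists_convPow_le (hd : 1 ≤ d) (hα : 0 < α) (hc₁ : 0 < c₁) (hc₂ : 0 < c₂) :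
    ∃ A : ℝ, 0 < A ∧ ∀ (L : ℕ) [NeZero L], 2 ≤ L → ∀ (V : ℝ), 1 ≤ V → ∀ p : Torus d L → ℝ,
      IsStableKernel p α V c₁ c₂ → ∀ n : ℕ, 1 ≤ n → ∀ x,
        convPow p n x ≤ A * (((n : ℝ) * V ^ α) ^ (-((d : ℝ) / α)) + 1 / (L : ℝ) ^ d) := by
  obtain ⟨A, hA, h⟩ := exists_energy_le (c₁ := c₁) (c₂ := c₂) hd hα hc₁ hc₂
  have hd0 : (0 : ℝ) < d := by exact_mod_cast hd
  set κ : ℝ := (3 : ℝ) ^ ((d : ℝ) / α) with hκ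
  have hκ1 : 1 ≤ κ := Real.one_le_rpow (by norm_num) (by positivity)
  refine ⟨max c₂ (A * κ), lt_max_of_lt_left hc₂, ?_⟩
  intro L _ hL V hV p hp n hn x
  have hV0 : 0 < V := by linarith
  have hL0 : (0 : ℝ) < L := by exact_mod_cast (by lia : 0 < L)
  have hy : 0 < 1 / (L : ℝ) ^ d := by positivity
  have hn0 : (0 : ℝ) < n := by exact_mod_cast hn
  have hx : 0 < ((n : ℝ) * V ^ α) ^ (-((d : ℝ) / α)) := by positivity
  rcases hn.eq_or_lt with rfl | hn2
  · rw [convPow_one]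
    refine (hp.le_rpow_neg hα hV hc₂ x).trans ?_
    have e1 : (((1 : ℕ) : ℝ) * V ^ α) ^ (-((d : ℝ) / α)) = V ^ (-(d : ℝ)) := by
      rw [Nat.cast_one, one_mul, ← Real.rpow_mul hV0.le]
      congr 1
      field_simp
    rw [← e1]
    exact mul_le_mul (le_max_left _ _) (by linarith) hx.le (hc₂.le.trans (le_max_left _ _))
  -- For `n ≥ 2` both `n / 2` and `n - n / 2` are at least `n / 3`, with equality at `n = 3`.
  · have part : ∀ m : ℕ, 1 ≤ m → n ≤ 3 * m →
        energy p m ≤ A * κ * (((n : ℝ) * V ^ α) ^ (-((d : ℝ) / α)) + 1 / (L : ℝ) ^ d) := by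
      intro m hm hnm
      have h1 := rpow_neg_le_of_le_three_mul (d := d) hα hV0 hn hnm
      rw [← hκ] at h1
      refine (h L hL V hV p hp m hm).trans ?_
      rw [mul_assoc]
      refine mul_le_mul_of_nonneg_left ?_ hA.le
      nlinarith
    have hadd := convPow_add_le p (n / 2) (n - n / 2) x
    rw [Nat.add_sub_cancel' (Nat.div_le_self n 2)] at hadd
    have h1 := part (n / 2) (by lia) (by lia)
    have h2 := part (n - n / 2) (by lia) (by lia)
    rw [energy] at h1 h2
    refine le_trans (b := A * κ * (((n : ℝ) * V ^ α) ^ (-((d : ℝ) / α)) + 1 / (L : ℝ) ^ d))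
      (by linarith) ?_
    exact mul_le_mul_of_nonneg_right (le_max_right _ _) (by positivity)

end OnDiagonal

/-- From `cosh u ≤ exp (u ^ 2 / 2)` one gets `cosh u * (1 - u ^ 2 / 2) ≤ 1`. The bound controls the
exponential moment of short jumps by their second moment. -/
theorem cosh_sub_one_le (u : ℝ) : Real.cosh u - 1 ≤ u ^ 2 * Real.exp |u| := by
  have h1 := Real.cosh_le_exp_half_sq u
  have hc := Real.cosh_pos u
  have h2 : Real.cosh u * Real.exp (-(u ^ 2 / 2)) ≤ 1 := by
    rw [Real.exp_neg, ← div_eq_mul_inv, div_le_one (Real.exp_pos _)]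
    exact h1
  have h3 := Real.add_one_le_exp (-(u ^ 2 / 2))
  have h4 : Real.cosh u ≤ Real.exp |u| := by
    rw [← Real.cosh_abs, Real.cosh_eq]
    have : Real.exp (-|u|) ≤ Real.exp |u| := Real.exp_le_exp.2 (by linarith [abs_nonneg u])
    linarith
  have h5 := mul_le_mul_of_nonneg_left h3 hc.le
  nlinarith [mul_le_mul_of_nonneg_right h4 (sq_nonneg u), mul_nonneg (Real.exp_pos |u|).le (sq_nonneg u)]

/-! ### Chernoff bounds on the torus. -/

section Torus

variable {d L : ℕ}

theorem abs_valMinAbs_add_le (a b : ZMod L) :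
    |((a + b).valMinAbs : ℝ)| ≤ |(a.valMinAbs : ℝ) + (b.valMinAbs : ℝ)| := by
  have h := ZMod.natAbs_valMinAbs_add_le a b
  have h2 : |(a + b).valMinAbs| ≤ |a.valMinAbs + b.valMinAbs| := by
    rw [Int.abs_eq_natAbs, Int.abs_eq_natAbs]
    exact_mod_cast h
  exact_mod_cast h2

theorem valMinAbs_neg_of_abs_lt {a : ZMod L} (ha : 2 * |(a.valMinAbs : ℝ)| < L) :
    (-a).valMinAbs = -a.valMinAbs := by
  refine ZMod.valMinAbs_neg_of_ne_half fun h => ?_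
  rw [← ZMod.valMinAbs_mul_two_eq_iff] at h
  have h1 : (a.valMinAbs : ℝ) * 2 = L := by exact_mod_cast h
  linarith [le_abs_self (a.valMinAbs : ℝ)]

theorem boxNorm_neg (x : Torus d L) : boxNorm (-x) = boxNorm x := by
  have h : ∀ a : ZMod L, |((-a).valMinAbs : ℝ)| = |(a.valMinAbs : ℝ)| := by
    intro a
    rw [← Int.cast_abs, ← Int.cast_abs, Int.abs_eq_natAbs, Int.abs_eq_natAbs,
      ZMod.natAbs_valMinAbs_neg]
  refine le_antisymm ((boxNorm_le_iff (boxNorm_nonneg _)).2 fun i => ?_)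
    ((boxNorm_le_iff (boxNorm_nonneg _)).2 fun i => ?_)
  · rw [Pi.neg_apply, h]
    exact abs_valMinAbs_le_boxNorm x i
  · rw [← h, ← Pi.neg_apply]
    exact abs_valMinAbs_le_boxNorm (-x) i

variable [NeZero L]

/-- Exponential moment of one step of a symmetric kernel with short range. -/
theorem sum_mul_cosh_add_le {a : Torus d L → ℝ} (ha : ∀ x, 0 ≤ a x) (hsymm : ∀ x, a (-x) = a x)
    {ρ : ℝ} (hρ : 2 * ρ < L) (hsupp : ∀ x, ρ < boxNorm x → a x = 0) (l : ℝ) (i : Fin d)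
    (x : Torus d L) :
    ∑ y, a y * Real.cosh (l * ((y + x) i).valMinAbs) ≤
      (∑ y, a y * Real.cosh (l * (y i).valMinAbs)) * Real.cosh (l * (x i).valMinAbs) := by
  -- The range `ρ` is below `L / 2`, so on the support of `a` the representative is an odd function.
  have hodd : ∑ y, a y * Real.sinh (l * (y i).valMinAbs) = 0 := by
    have h : ∑ y, a y * Real.sinh (l * (y i).valMinAbs) =
        -∑ y, a y * Real.sinh (l * (y i).valMinAbs) := by
      rw [← sum_neg_distrib,
        ← Equiv.sum_comp (Equiv.neg _) fun y => a y * Real.sinh (l * (y i).valMinAbs)]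
      refine sum_congr rfl fun y _ => ?_
      rw [Equiv.neg_apply, hsymm, Pi.neg_apply]
      rcases le_or_gt (boxNorm y) ρ with hy | hy
      · rw [valMinAbs_neg_of_abs_lt (by linarith [abs_valMinAbs_le_boxNorm y i])]
        push_cast
        rw [mul_neg, Real.sinh_neg, mul_neg]
      · rw [hsupp y hy]
        ring
    linarith
  calc ∑ y, a y * Real.cosh (l * ((y + x) i).valMinAbs)
      -- Wrapping around only shortens a sum, and `cosh` is monotone in the absolute value; this is
      -- why the weight is `cosh` rather than an exponential.
      ≤ ∑ y, a y * Real.cosh (l * (y i).valMinAbs + l * (x i).valMinAbs) := by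
        refine sum_le_sum fun y _ => mul_le_mul_of_nonneg_left ?_ (ha y)
        rw [Real.cosh_le_cosh, ← mul_add, abs_mul, abs_mul, Pi.add_apply]
        exact mul_le_mul_of_nonneg_left (abs_valMinAbs_add_le _ _) (abs_nonneg l)
    _ = ∑ y, (a y * Real.cosh (l * (y i).valMinAbs) * Real.cosh (l * (x i).valMinAbs) +
          a y * Real.sinh (l * (y i).valMinAbs) * Real.sinh (l * (x i).valMinAbs)) :=
        sum_congr rfl fun y _ => by rw [Real.cosh_add]; ring
    _ = _ := by rw [sum_add_distrib, ← sum_mul, ← sum_mul, hodd, zero_mul, add_zero]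

/-- Chernoff bound for one coordinate of a walk with symmetric short-range steps. -/
theorem sum_convPow_tail_le {a : Torus d L → ℝ} (ha : ∀ x, 0 ≤ a x) (ha1 : ∑ x, a x ≤ 1)
    (hsymm : ∀ x, a (-x) = a x) {ρ : ℝ} (hρ : 2 * ρ < L)
    (hsupp : ∀ x, ρ < boxNorm x → a x = 0) {l : ℝ} (hl : 0 ≤ l) {σ : ℝ}
    (hσ : ∑ x, a x * boxNorm x ^ 2 ≤ σ) (i : Fin d) (n : ℕ) {s : ℝ} (hs : 0 ≤ s) :
    ∑ x : Torus d L with s ≤ |((x i).valMinAbs : ℝ)|, convPow a n x ≤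
      2 * Real.exp (n * (l ^ 2 * Real.exp (l * ρ) * σ)) * Real.exp (-(l * s)) := by
  set M := ∑ y, a y * Real.cosh (l * (y i).valMinAbs) with hM
  have hM0 : 0 ≤ M := sum_nonneg fun y _ => mul_nonneg (ha y) (Real.cosh_pos _).le
  have hM1 : M ≤ Real.exp (l ^ 2 * Real.exp (l * ρ) * σ) := by
    have hterm : ∀ y, a y * Real.cosh (l * (y i).valMinAbs) ≤
        a y + l ^ 2 * Real.exp (l * ρ) * (a y * boxNorm y ^ 2) := by
      intro y
      rcases le_or_gt (boxNorm y) ρ with hy | hy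
      · have h1 := cosh_sub_one_le (l * (y i).valMinAbs)
        have h2 := abs_valMinAbs_le_boxNorm y i
        have h3 : (l * ((y i).valMinAbs : ℝ)) ^ 2 ≤ l ^ 2 * boxNorm y ^ 2 := by
          rw [mul_pow, ← sq_abs ((y i).valMinAbs : ℝ)]
          exact mul_le_mul_of_nonneg_left (pow_le_pow_left₀ (abs_nonneg _) h2 2) (sq_nonneg l)
        have h4 : Real.exp |l * ((y i).valMinAbs : ℝ)| ≤ Real.exp (l * ρ) := by
          rw [Real.exp_le_exp, abs_mul, abs_of_nonneg hl]
          exact mul_le_mul_of_nonneg_left (h2.trans hy) hl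
        have h5 := mul_le_mul h3 h4 (Real.exp_pos _).le (by positivity)
        have h6 := mul_le_mul_of_nonneg_left (h1.trans h5) (ha y)
        linarith
      · rw [hsupp y hy]
        simp
    refine (sum_le_sum fun y _ => hterm y).trans ?_
    rw [sum_add_distrib, ← mul_sum]
    have h1 := mul_le_mul_of_nonneg_left hσ
      (by positivity : 0 ≤ l ^ 2 * Real.exp (l * ρ))
    linarith [Real.add_one_le_exp (l ^ 2 * Real.exp (l * ρ) * σ)]
  have hmom : ∑ x, convPow a n x * Real.cosh (l * (x i).valMinAbs) ≤ M ^ n :=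
    sum_convPow_mul_le (w := fun x : Torus d L => Real.cosh (l * (x i).valMinAbs)) ha hM0
      (by simp) (sum_mul_cosh_add_le ha hsymm hρ hsupp l i) n
  have hpow : M ^ n ≤ Real.exp (n * (l ^ 2 * Real.exp (l * ρ) * σ)) := by
    rw [Real.exp_nat_mul]
    exact pow_le_pow_left₀ hM0 hM1 n
  have htail : (∑ x : Torus d L with s ≤ |((x i).valMinAbs : ℝ)|, convPow a n x) *
      (Real.exp (l * s) / 2) ≤ ∑ x, convPow a n x * Real.cosh (l * (x i).valMinAbs) := by
    rw [sum_mul]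
    refine (sum_le_sum fun x hx => ?_).trans (sum_le_sum_of_subset_of_nonneg (filter_subset _ _)
      fun x _ _ => mul_nonneg (convPow_nonneg ha n x) (Real.cosh_pos _).le)
    refine mul_le_mul_of_nonneg_left ?_ (convPow_nonneg ha n x)
    have h1 : Real.exp (l * s) / 2 ≤ Real.cosh (l * s) := by
      rw [Real.cosh_eq]
      linarith [Real.exp_pos (-(l * s))]
    refine h1.trans (Real.cosh_le_cosh.2 ?_)
    rw [abs_mul, abs_mul, abs_of_nonneg hs]
    exact mul_le_mul_of_nonneg_left (mem_filter.1 hx).2 (abs_nonneg l)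
  have h := htail.trans (hmom.trans hpow)
  rw [Real.exp_neg, ← div_eq_mul_inv, le_div_iff₀ (Real.exp_pos _)]
  linarith

/-- If a walk reaches `x`, it makes half of the displacement in a given coordinate during one of
the two parts of a time interval. -/
theorem convPow_add_le_of_tail {a : Torus d L → ℝ} (ha : ∀ x, 0 ≤ a x) (m n : ℕ) {S τ : ℝ}
    (hS : 0 ≤ S) (hm : ∀ x, convPow a m x ≤ S) (hn : ∀ x, convPow a n x ≤ S)
    (i : Fin d) (x : Torus d L)
    (hm' : ∑ y : Torus d L with |((x i).valMinAbs : ℝ)| / 2 ≤ |((y i).valMinAbs : ℝ)|,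
      convPow a m y ≤ τ)
    (hn' : ∑ y : Torus d L with |((x i).valMinAbs : ℝ)| / 2 ≤ |((y i).valMinAbs : ℝ)|,
      convPow a n y ≤ τ) : convPow a (m + n) x ≤ 2 * S * τ := by
  set P : Torus d L → Prop := fun y => |((x i).valMinAbs : ℝ)| / 2 ≤ |((y i).valMinAbs : ℝ)|
    with hP
  classical
  have hsplit : ∀ y, convPow a m y * convPow a n (x - y) ≤
      S * (if P y then convPow a m y else 0) + S * (if P (x - y) then convPow a n (x - y) else 0) := by
    intro y
    have h0 := convPow_nonneg ha m y
    have h1 := convPow_nonneg ha n (x - y)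
    by_cases hy : P y
    · rw [if_pos hy]
      have h2 : 0 ≤ S * (if P (x - y) then convPow a n (x - y) else 0) := by
        split_ifs <;> positivity
      nlinarith [mul_le_mul_of_nonneg_left (hn (x - y)) h0]
    -- Two displacements both shorter than half of `|x i|` cannot add up to `x i`.
    · have hxy : P (x - y) := by
        by_contra h
        simp only [hP, not_le] at h hy
        have h3 := abs_valMinAbs_add_le (y i) ((x - y) i)
        rw [Pi.sub_apply, add_sub_cancel] at h3
        rw [Pi.sub_apply] at h
        have h4 := abs_add_le ((y i).valMinAbs : ℝ) ((x i - y i).valMinAbs : ℝ)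
        linarith
      rw [if_neg hy, if_pos hxy, mul_zero, zero_add]
      exact mul_le_mul_of_nonneg_right (hm y) h1
  rw [convPow_add]
  refine (sum_le_sum fun y _ => hsplit y).trans ?_
  rw [sum_add_distrib, ← mul_sum, ← mul_sum,
    sum_sub_left_eq fun y => if P y then convPow a n y else 0, ← sum_filter, ← sum_filter]
  have h1 := mul_le_mul_of_nonneg_left hm' hS
  have h2 := mul_le_mul_of_nonneg_left hn' hS
  simp only [hP]
  linarith

end Torus

/-! ### The off-diagonal bound by truncation. -/

section OffDiagonal

variable {d : ℕ} {α c₁ c₂ : ℝ}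

/-- The truncation of a kernel to jumps of length at most `ρ`. -/
noncomputable def truncate {L : ℕ} (p : Torus d L → ℝ) (ρ : ℝ) (x : Torus d L) : ℝ :=
  if boxNorm x ≤ ρ then p x else 0

/-- The second moment of the truncation of a stable-like kernel. -/
theorem IsStableKernel.sum_truncate_mul_sq_le {L : ℕ} [NeZero L] {p : Torus d L → ℝ} {V : ℝ}
    (hp : IsStableKernel p α V c₁ c₂) (hα : 0 < α) (hV : 0 < V) (hc₂ : 0 < c₂) (ρ : ℝ) :
    ∑ y, truncate p ρ y * boxNorm y ^ 2 ≤ c₂ * V ^ α *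
      ∑ y : Torus d L with boxNorm y ≤ ρ, boxNorm y ^ 2 * boxNorm y ^ (-(d : ℝ) - α) := by
  rw [mul_sum, sum_filter]
  refine sum_le_sum fun y _ => ?_
  simp only [truncate]
  split_ifs
  · rcases eq_or_ne y 0 with rfl | hy
    · simp [boxNorm_zero]
    · have hy0 : 0 < boxNorm y := zero_lt_one.trans_le (one_le_boxNorm hy)
      have h2 : max (boxNorm y) V ^ (-(d : ℝ) - α) ≤ boxNorm y ^ (-(d : ℝ) - α) :=
        Real.rpow_le_rpow_of_nonpos hy0 (le_max_left _ _)
          (by linarith [Nat.cast_nonneg (α := ℝ) d])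
      calc p y * boxNorm y ^ 2
          ≤ c₂ * (V ^ α * max (boxNorm y) V ^ (-(d : ℝ) - α)) * boxNorm y ^ 2 :=
            mul_le_mul_of_nonneg_right (hp.upper y) (sq_nonneg _)
        _ ≤ c₂ * (V ^ α * boxNorm y ^ (-(d : ℝ) - α)) * boxNorm y ^ 2 := by gcongr
        _ = _ := by ring
  · rw [zero_mul]

/-- Interpolation between the on-diagonal profile and the stable tail. -/
theorem profile_mul_le {b T m ε : ℝ} (hb : 0 < b) (hα : 0 < α) (hT : 0 < T) (hm : 0 < m)
    (hTm : T < m ^ α) (hε : 0 ≤ ε) :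
    (T ^ (-(b / α)) + ε) * (T / m ^ α) ^ (1 + b / α) ≤ T * m ^ (-b - α) + ε := by
  have h1 : T ^ (-(b / α)) * (T / m ^ α) ^ (1 + b / α) = T * m ^ (-b - α) := by
    rw [Real.div_rpow hT.le (by positivity), ← Real.rpow_mul hm.le, mul_div_assoc',
      ← Real.rpow_add hT, div_eq_mul_inv, ← Real.rpow_neg hm.le]
    congr 1
    · rw [show -(b / α) + (1 + b / α) = 1 by ring, Real.rpow_one]
    · congr 1
      field_simp
      ring
  have h2 : (T / m ^ α) ^ (1 + b / α) ≤ 1 :=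
    Real.rpow_le_one (by positivity) ((div_lt_one (by positivity)).2 hTm).le (by positivity)
  rw [add_mul, h1]
  nlinarith

/-- The upper bound for the `n`-step transition probabilities of a stable-like kernel away from
the diagonal. -/
theorem exists_convPow_le_offDiagonal (hd : 1 ≤ d) (hα : α ∈ Set.Ioo (0 : ℝ) 2) (hc₁ : 0 < c₁)
    (hc₂ : 0 < c₂) :
    ∃ C : ℝ, 0 < C ∧ ∀ (L : ℕ) [NeZero L], 2 ≤ L → ∀ (V : ℝ), 1 ≤ V → ∀ p : Torus d L → ℝ,
      IsStableKernel p α V c₁ c₂ → ∀ n : ℕ, 1 ≤ n → ∀ x,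
        convPow p n x ≤
          C * ((n : ℝ) * V ^ α * max (boxNorm x) V ^ (-(d : ℝ) - α) + 1 / (L : ℝ) ^ d) := by
  have hα0 : 0 < α := hα.1
  obtain ⟨A, hA, hdiag⟩ := exists_convPow_le (c₁ := c₁) (c₂ := c₂) hd hα0 hc₁ hc₂
  obtain ⟨K, hK, hmoment⟩ := exists_sum_boxNorm_sq_le d hα
  have hd0 : (0 : ℝ) < d := by exact_mod_cast hd
  set κ : ℝ := (3 : ℝ) ^ ((d : ℝ) / α) with hκ
  have hκ1 : 1 ≤ κ := Real.one_le_rpow (by norm_num) (by positivity)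
  -- With `ρ = m / k` and `t = exp (-(2 * u))`, the Chernoff factor `exp (-(l * m / 2))` at `l = u /
  -- ρ` is exactly `t ^ (1 + d / α)`.
  set k : ℝ := 4 * (1 + d / α) with hk
  have hda : (0 : ℝ) < d / α := by positivity
  have hk1 : 1 < k := by linarith
  have hk0 : 0 < k := by linarith
  set Q : ℝ := 2 * c₂ * K * k ^ α with hQ
  set C₁ : ℝ := c₂ * k ^ ((d : ℝ) + α) with hC₁
  set C₂ : ℝ := 4 * (A * κ) * Real.exp Q with hC₂
  have hC₁0 : 0 < C₁ := by positivity
  have hC₂0 : 0 < C₂ := by positivity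
  refine ⟨A + c₂ + (C₁ + C₂), by positivity, ?_⟩
  intro L _ hL V hV p hp n hn x
  have hV0 : 0 < V := by linarith
  have hL0 : (0 : ℝ) < L := by exact_mod_cast (by lia : 0 < L)
  have hN : 0 < 1 / (L : ℝ) ^ d := by positivity
  have hn0 : (0 : ℝ) < n := by exact_mod_cast hn
  have hn1 : (1 : ℝ) ≤ n := by exact_mod_cast hn
  set T : ℝ := n * V ^ α with hT
  have hT0 : 0 < T := by positivity
  set m := max (boxNorm x) V with hm
  have hm0 : 0 < m := hV0.trans_le (le_max_right _ _)
  have hB : 0 < T * m ^ (-(d : ℝ) - α) := by positivity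
  have hexp : -(d : ℝ) - α ≤ 0 := by linarith
  rcases le_or_gt (m ^ α) T with hTm | hTm
  · have h1 : T ^ (-((d : ℝ) / α)) ≤ T * m ^ (-(d : ℝ) - α) := by
      calc T ^ (-((d : ℝ) / α)) ≤ (m ^ α) ^ (-((d : ℝ) / α)) :=
            Real.rpow_le_rpow_of_nonpos (by positivity) hTm (neg_nonpos.2 hda.le)
        _ = m ^ α * m ^ (-(d : ℝ) - α) := by
            rw [← Real.rpow_mul hm0.le, ← Real.rpow_add hm0]
            congr 1
            field_simp
            ring
        _ ≤ T * m ^ (-(d : ℝ) - α) := mul_le_mul_of_nonneg_right hTm (by positivity)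
    refine (hdiag L hL V hV p hp n hn x).trans ?_
    exact mul_le_mul (by linarith) (by linarith) (by positivity) (by positivity)
  · have hVm : V ^ α < m ^ α := lt_of_le_of_lt (by rw [hT]; nlinarith [Real.rpow_pos_of_pos hV0 α]) hTm
    have hVm' : V < m := (Real.rpow_lt_rpow_iff hV0.le hm0.le hα0).1 hVm
    have hmr : m = boxNorm x := by
      rcases max_choice (boxNorm x) V with h | h
      · exact h
      · rw [← hm] at h
        exact absurd h hVm'.ne'
    rcases hn.eq_or_lt with h1 | hn2
    · subst h1
      rw [convPow_one]
      refine (hp.upper x).trans ?_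
      rw [← hm]
      have : V ^ α * m ^ (-(d : ℝ) - α) = T * m ^ (-(d : ℝ) - α) := by rw [hT]; simp
      rw [this]
      exact mul_le_mul (by linarith) (by linarith) hB.le (by positivity)
    obtain ⟨i, hi⟩ := exists_boxNorm_eq hd x
    set ρ : ℝ := m / k with hρ
    have hρ0 : 0 < ρ := by positivity
    have hρm : ρ < m := div_lt_self hm0 hk1
    -- Strictness comes from `k > 1`, and it keeps the truncated kernel away from the face where
    -- symmetry may fail.
    have hρL : 2 * ρ < L := by
      have := boxNorm_le_half x
      rw [← hmr] at this
      linarith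
    set a : Torus d L → ℝ := truncate p ρ with ha
    have ha0 : ∀ y, 0 ≤ a y := by
      intro y
      simp only [ha, truncate]
      split_ifs
      · exact hp.nonneg y
      · exact le_rfl
    have hap : ∀ y, a y ≤ p y := by
      intro y
      simp only [ha, truncate]
      split_ifs
      · exact le_rfl
      · exact hp.nonneg y
    have ha1 : ∑ y, a y ≤ 1 := hp.sum_eq_one ▸ sum_le_sum fun y _ => hap y
    have hsymm : ∀ y, a (-y) = a y := by
      intro y
      simp only [ha, truncate, boxNorm_neg]
      split_ifs with h
      · exact hp.symm y fun j => by linarith [abs_valMinAbs_le_boxNorm y j]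
      · rfl
    have hsupp : ∀ y, ρ < boxNorm y → a y = 0 := fun y hy => if_neg hy.not_ge
    have hjump : ∀ y, p y - a y ≤ C₁ * (V ^ α * m ^ (-(d : ℝ) - α)) := by
      intro y
      simp only [ha, truncate]
      split_ifs with h
      · rw [sub_self]
        positivity
      · rw [sub_zero]
        rw [not_le] at h
        refine (hp.upper y).trans ?_
        have h2 : max (boxNorm y) V ^ (-(d : ℝ) - α) ≤ ρ ^ (-(d : ℝ) - α) :=
          Real.rpow_le_rpow_of_nonpos hρ0 (h.le.trans (le_max_left _ _)) hexp
        have h3 : ρ ^ (-(d : ℝ) - α) = k ^ ((d : ℝ) + α) * m ^ (-(d : ℝ) - α) := by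
          rw [hρ, Real.div_rpow hm0.le hk0.le, div_eq_mul_inv, ← Real.rpow_neg hk0.le, mul_comm]
          congr 2
          ring
        rw [h3] at h2
        calc c₂ * (V ^ α * max (boxNorm y) V ^ (-(d : ℝ) - α))
            ≤ c₂ * (V ^ α * (k ^ ((d : ℝ) + α) * m ^ (-(d : ℝ) - α))) := by gcongr
          _ = C₁ * (V ^ α * m ^ (-(d : ℝ) - α)) := by rw [hC₁]; ring
    have hσ : ∑ y, a y * boxNorm y ^ 2 ≤ c₂ * V ^ α * (K * ρ ^ (2 - α)) := by
      exact (hp.sum_truncate_mul_sq_le hα0 hV0 hc₂ ρ).trans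
        (mul_le_mul_of_nonneg_left (hmoment L ρ hρ0.le) (by positivity))
    set t : ℝ := T / m ^ α with ht
    have ht0 : 0 < t := by positivity
    have ht1 : t < 1 := (div_lt_one (by positivity)).2 hTm
    -- The factor one half leaves a spare `exp (-u)`: the exponent is of order `u ^ 2 * t * exp u =
    -- u ^ 2 * exp (-u)`, which is bounded.
    set u : ℝ := -Real.log t / 2 with hu
    have hu0 : 0 ≤ u := by linarith [Real.log_nonpos ht0.le ht1.le]
    have htu : t = Real.exp (-(2 * u)) := by
      rw [hu, show -(2 * (-Real.log t / 2)) = Real.log t by ring, Real.exp_log ht0]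
    set l : ℝ := u / ρ with hl
    have hl0 : 0 ≤ l := by positivity
    have hlρ : l * ρ = u := div_mul_cancel₀ u hρ0.ne'
    have hu2 : u ^ 2 * Real.exp (-u) ≤ 2 := by
      have := Real.quadratic_le_exp_of_nonneg hu0
      rw [Real.exp_neg, ← div_eq_mul_inv, div_le_iff₀ (Real.exp_pos _)]
      nlinarith
    have hexponent : (n : ℝ) * (l ^ 2 * Real.exp (l * ρ) * (c₂ * V ^ α * (K * ρ ^ (2 - α)))) ≤ Q := by
      have e1 : ρ ^ (2 - α) = ρ ^ 2 * (ρ ^ α)⁻¹ := by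
        rw [Real.rpow_sub hρ0, Real.rpow_two, div_eq_mul_inv]
      have e2 : (ρ ^ α)⁻¹ = k ^ α * (m ^ α)⁻¹ := by
        rw [hρ, Real.div_rpow hm0.le hk0.le, inv_div, div_eq_mul_inv]
      have e3 : t * Real.exp u = Real.exp (-u) := by
        rw [htu, ← Real.exp_add]
        congr 1
        ring
      calc (n : ℝ) * (l ^ 2 * Real.exp (l * ρ) * (c₂ * V ^ α * (K * ρ ^ (2 - α))))
          = c₂ * K * k ^ α * ((l * ρ) ^ 2 * (T / m ^ α * Real.exp (l * ρ))) := by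
            rw [e1, e2, hT]; ring
        _ = c₂ * K * k ^ α * (u ^ 2 * Real.exp (-u)) := by rw [hlρ, ← ht, e3]
        _ ≤ c₂ * K * k ^ α * 2 := mul_le_mul_of_nonneg_left hu2 (by positivity)
        _ = Q := by rw [hQ]; ring
    have htail : ∀ j : ℕ, j ≤ n →
        ∑ y : Torus d L with |((x i).valMinAbs : ℝ)| / 2 ≤ |((y i).valMinAbs : ℝ)|,
          convPow a j y ≤ 2 * Real.exp Q * t ^ (1 + d / α) := by
      intro j hj
      have h1 := sum_convPow_tail_le ha0 ha1 hsymm hρL hsupp hl0 hσ i j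
        (s := |((x i).valMinAbs : ℝ)| / 2) (by positivity)
      refine h1.trans ?_
      have h2 : Real.exp (-(l * (|((x i).valMinAbs : ℝ)| / 2))) = t ^ (1 + d / α) := by
        rw [htu, ← Real.exp_mul, ← hi, ← hmr]
        congr 1
        have : m = k * ρ := by rw [hρ]; field_simp
        rw [this, hk]
        linear_combination (-(2 * (1 + d / α)) : ℝ) * hlρ
      rw [h2]
      have h3 : (j : ℝ) * (l ^ 2 * Real.exp (l * ρ) * (c₂ * V ^ α * (K * ρ ^ (2 - α)))) ≤ Q := by
        refine le_trans ?_ hexponent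
        exact mul_le_mul_of_nonneg_right (by exact_mod_cast hj) (by positivity)
      gcongr
    set S : ℝ := A * κ * (T ^ (-((d : ℝ) / α)) + 1 / (L : ℝ) ^ d) with hS
    have hS0 : 0 ≤ S := by positivity
    have hsup : ∀ j : ℕ, 1 ≤ j → n ≤ 3 * j → ∀ y, convPow a j y ≤ S := by
      intro j hj hnj y
      refine (convPow_mono ha0 hap j y).trans ((hdiag L hL V hV p hp j hj y).trans ?_)
      have h1 := rpow_neg_le_of_le_three_mul (d := d) hα0 hV0 hn hnj
      rw [hS, mul_assoc]
      refine mul_le_mul_of_nonneg_left ?_ hA.le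
      rw [mul_add]
      exact add_le_add h1 (le_mul_of_one_le_left hN.le hκ1)
    have hshort := convPow_add_le_of_tail ha0 (n / 2) (n - n / 2) hS0
      (hsup (n / 2) (by lia) (by lia)) (hsup (n - n / 2) (by lia) (by lia)) i x
      (htail (n / 2) (by lia)) (htail (n - n / 2) (by lia))
    rw [Nat.add_sub_cancel' (Nat.div_le_self n 2)] at hshort
    -- The exponent `1 + d / α` is what turns `T ^ (-d / α)` into `T * m ^ (-d - α)`.
    have hprod := profile_mul_le hd0 hα0 hT0 hm0 hTm hN.le
    rw [← ht] at hprod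
    have hlong := convPow_le_truncated_add ha0 hap hp.sum_eq_one (by positivity) hjump n x
    calc convPow p n x
        ≤ convPow a n x + n * (C₁ * (V ^ α * m ^ (-(d : ℝ) - α))) := hlong
      _ ≤ 2 * S * (2 * Real.exp Q * t ^ (1 + d / α)) + C₁ * (T * m ^ (-(d : ℝ) - α)) := by
          refine add_le_add hshort (le_of_eq ?_)
          rw [hT]; ring
      _ = C₂ * ((T ^ (-((d : ℝ) / α)) + 1 / (L : ℝ) ^ d) * t ^ (1 + d / α)) +
          C₁ * (T * m ^ (-(d : ℝ) - α)) := by rw [hS, hC₂]; ring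
      _ ≤ C₂ * (T * m ^ (-(d : ℝ) - α) + 1 / (L : ℝ) ^ d) +
          C₁ * (T * m ^ (-(d : ℝ) - α) + 1 / (L : ℝ) ^ d) :=
          add_le_add (mul_le_mul_of_nonneg_left hprod hC₂0.le)
            (mul_le_mul_of_nonneg_left (by linarith) hC₁0.le)
      _ ≤ (A + c₂ + (C₁ + C₂)) * (T * m ^ (-(d : ℝ) - α) + 1 / (L : ℝ) ^ d) := by
          have : 0 ≤ (A + c₂) * (T * m ^ (-(d : ℝ) - α) + 1 / (L : ℝ) ^ d) := by positivity
          linarith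

end OffDiagonal

/-! ### The circulant walk as a stable-like kernel. -/

section Walk

variable {d L : ℕ}

theorem rep_neg {x : Torus d L} (hx : ∀ i, 2 * |((x i).valMinAbs : ℝ)| < L) :
    rep (-x) = -rep x := by
  ext i
  simp [rep, valMinAbs_neg_of_abs_lt (hx i)]

variable [NeZero L] {W : ℝ} {f : EuclideanSpace ℝ (Fin d) → ℝ}

/-- The law of one step of the circulant walk. -/
noncomputable def stepLaw (L : ℕ) [NeZero L] (W : ℝ) (f : EuclideanSpace ℝ (Fin d) → ℝ) (x : Torus d L) : ℝ :=
  if x = 0 then 0 else f (W⁻¹ • rep x) / Omega L W f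

theorem transition_pow_apply (n : ℕ) (x y : Torus d L) :
    (transition L W f ^ n) x y = convPow (stepLaw L W f) n (y - x) := by
  induction n generalizing x y with
  | zero => simp [convPow, Matrix.one_apply, sub_eq_zero, eq_comm]
  | succ n ih =>
    rw [pow_succ', Matrix.mul_apply]
    simp only [convPow]
    -- Translation by `x` turns the matrix product into a convolution.
    rw [← Equiv.sum_comp (Equiv.addRight x)]
    refine sum_congr rfl fun z _ => ?_
    rw [ih, Equiv.coe_addRight]
    congr 1
    · simp [transition, stepLaw]
    · rw [sub_add_eq_sub_sub_swap]

theorem stepProb_eq_convPow (n : ℕ) (x : Torus d L) :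
    stepProb L W f n x = convPow (stepLaw L W f) n x := by
  rw [stepProb, transition_pow_apply, sub_zero]

theorem sum_stepLaw (hΩ : Omega L W f ≠ 0) : ∑ x, stepLaw L W f x = 1 := by
  have h : ∀ x : Torus d L, stepLaw L W f x =
      if x ≠ 0 then f (W⁻¹ • rep x) / Omega L W f else 0 := fun x => by
    simp only [stepLaw, ite_not]
  simp_rw [h]
  rw [← sum_filter, ← sum_div, ← Omega, div_self hΩ]

theorem stepLaw_neg (hf : ∀ x, f (-x) = f x) {x : Torus d L}
    (hx : ∀ i, 2 * |((x i).valMinAbs : ℝ)| < L) : stepLaw L W f (-x) = stepLaw L W f x := by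
  simp only [stepLaw, neg_eq_zero, rep_neg hx, smul_neg, hf]

/-- Comparison of the profile on the Euclidean space with the profile of the box norm at a
scale which is at least one. -/
theorem exists_profile_bounds (hd : 1 ≤ d) {α W₀ : ℝ} (hα : 0 < α) (hW₀ : 0 < W₀)
    (hf : Comparable f fun x => (max ‖x‖ 1) ^ (-(d : ℝ) - α)) :
    ∃ b₁ b₂ : ℝ, 0 < b₁ ∧ 0 < b₂ ∧ ∀ (L : ℕ) [NeZero L] (W : ℝ), W₀ ≤ W → ∀ x : Torus d L,
      b₁ * (max W 1 ^ ((d : ℝ) + α) * max (boxNorm x) (max W 1) ^ (-(d : ℝ) - α)) ≤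
        f (W⁻¹ • rep x) ∧
      f (W⁻¹ • rep x) ≤
        b₂ * (max W 1 ^ ((d : ℝ) + α) * max (boxNorm x) (max W 1) ^ (-(d : ℝ) - α)) := by
  obtain ⟨C₁, C₂, hC₁, hC₂, hC⟩ := hf
  have hd1 : (1 : ℝ) ≤ d := by exact_mod_cast hd
  have hsd : 1 ≤ √(d : ℝ) := Real.one_le_sqrt.2 hd1
  have hexp : -(d : ℝ) - α ≤ 0 := by linarith
  -- The ratio between `W` and `max W 1` is at least `w`; this is how the constants depend on `W₀`.
  set w := min W₀ 1 with hw
  have hw0 : 0 < w := lt_min hW₀ one_pos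
  have hw1 : w ≤ 1 := min_le_right _ _
  set D : ℝ := √d / w with hD
  have hD1 : 1 ≤ D := by
    rw [hD, le_div_iff₀ hw0]
    linarith
  have hD0 : 0 < D := by linarith
  refine ⟨C₁ * D ^ (-(d : ℝ) - α), C₂, by positivity, hC₂, ?_⟩
  intro L _ W hW x
  have hW0 : 0 < W := hW₀.trans_le hW
  set V := max W 1 with hV
  have hV1 : 1 ≤ V := le_max_right _ _
  have hV0 : 0 < V := by linarith
  have hWV : W ≤ V := le_max_left _ _
  have hwV : w * V ≤ W := by
    rcases max_choice W 1 with h | h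
    · rw [hV, h]
      nlinarith
    · rw [hV, h, mul_one]
      exact (min_le_left _ _).trans hW
  have hnorm : ‖W⁻¹ • rep x‖ = torusNorm x / W := by
    rw [norm_smul, norm_inv, Real.norm_of_nonneg hW0.le, torusNorm, inv_mul_eq_div]
  have hb0 := boxNorm_nonneg x
  set m := max (boxNorm x) V with hm
  have hm0 : 0 < m := hV0.trans_le (le_max_right _ _)
  have hprof : V ^ ((d : ℝ) + α) * m ^ (-(d : ℝ) - α) = (m / V) ^ (-(d : ℝ) - α) := by
    rw [Real.div_rpow hm0.le hV0.le, div_eq_mul_inv, ← Real.rpow_neg hV0.le, mul_comm]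
    congr 2
    ring
  have hlow : m / V ≤ max ‖W⁻¹ • rep x‖ 1 := by
    rw [div_le_iff₀ hV0]
    refine max_le ?_ ?_
    · refine le_trans ?_ (mul_le_mul_of_nonneg_right (le_max_left _ _) hV0.le)
      rw [hnorm, div_mul_eq_mul_div, le_div_iff₀ hW0]
      exact mul_le_mul (boxNorm_le_torusNorm x) hWV hW0.le (norm_nonneg _)
    · exact le_mul_of_one_le_left hV0.le (le_max_right _ _)
  have hup : max ‖W⁻¹ • rep x‖ 1 ≤ D * (m / V) := by
    refine max_le ?_ ?_
    · rw [hnorm, div_le_iff₀ hW0]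
      have h1 : torusNorm x ≤ √d * m :=
        (torusNorm_le_sqrt_mul_boxNorm x).trans
          (mul_le_mul_of_nonneg_left (le_max_left _ _) (Real.sqrt_nonneg _))
      refine h1.trans ?_
      have h2 : D * (m / V) * W = √d * m * (W / (w * V)) := by
        rw [hD]
        field_simp
      rw [h2]
      exact le_mul_of_one_le_right (by positivity) ((one_le_div (by positivity)).2 hwV)
    · have : 1 ≤ m / V := (one_le_div hV0).2 (le_max_right _ _)
      nlinarith
  have hmV : 0 < m / V := by positivity
  rw [hprof]
  constructor
  · refine le_trans ?_ (hC _).1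
    rw [mul_assoc, ← Real.mul_rpow hD0.le hmV.le]
    exact mul_le_mul_of_nonneg_left (Real.rpow_le_rpow_of_nonpos
      (lt_max_of_lt_right one_pos) hup hexp) hC₁.le
  · refine (hC _).2.trans ?_
    exact mul_le_mul_of_nonneg_left (Real.rpow_le_rpow_of_nonpos hmV hlow hexp) hC₂.le

/-- Upper bound for the sum of the stable profile over the torus. -/
theorem exists_sum_profile_le (d : ℕ) {α : ℝ} (hα : α ∈ Set.Ioo (0 : ℝ) 2) :
    ∃ K : ℝ, 0 < K ∧ ∀ (L : ℕ) [NeZero L] (V : ℝ), 1 ≤ V →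
      ∑ x : Torus d L, V ^ ((d : ℝ) + α) * max (boxNorm x) V ^ (-(d : ℝ) - α) ≤ K * V ^ d := by
  obtain ⟨K, hK, htail⟩ := exists_sum_tail_le d hα
  refine ⟨3 ^ d + K, by positivity, ?_⟩
  intro L _ V hV
  have hV0 : 0 < V := by linarith
  rw [← sum_filter_add_sum_filter_not univ fun x : Torus d L => boxNorm x ≤ V, add_mul]
  refine add_le_add ?_ ?_
  · calc ∑ x : Torus d L with boxNorm x ≤ V,
          V ^ ((d : ℝ) + α) * max (boxNorm x) V ^ (-(d : ℝ) - α)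
        = ∑ x : Torus d L with boxNorm x ≤ V, (1 : ℝ) := by
          refine sum_congr rfl fun x hx => ?_
          rw [max_eq_right (mem_filter.1 hx).2, ← Real.rpow_add hV0,
            show (d : ℝ) + α + (-(d : ℝ) - α) = 0 by ring, Real.rpow_zero]
      _ = #{x : Torus d L | boxNorm x ≤ V} := by rw [sum_const, nsmul_eq_mul, mul_one]
      _ ≤ 3 ^ d * V ^ d := by
          rw [← mul_pow]
          exact card_boxNorm_le hV
  · simp only [not_le]
    calc ∑ x : Torus d L with V < boxNorm x,
          V ^ ((d : ℝ) + α) * max (boxNorm x) V ^ (-(d : ℝ) - α)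
        = V ^ ((d : ℝ) + α) * ∑ x : Torus d L with V < boxNorm x,
            boxNorm x ^ (-(d : ℝ) - α) := by
          rw [mul_sum]
          refine sum_congr rfl fun x hx => ?_
          rw [max_eq_left (mem_filter.1 hx).2.le]
      _ ≤ V ^ ((d : ℝ) + α) * (K * V ^ (-α)) :=
          mul_le_mul_of_nonneg_left (htail L V hV) (by positivity)
      _ = K * V ^ d := by
          rw [mul_left_comm, ← Real.rpow_add hV0, add_neg_cancel_right, Real.rpow_natCast]

/-- Lower bound for the normalization when the bandwidth does not exceed the side. -/
theorem le_Omega (hd : 1 ≤ d) {α V b : ℝ} (hV : 1 ≤ V) (hb : 0 ≤ b)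
    (hf : ∀ x : Torus d L,
      b * (V ^ ((d : ℝ) + α) * max (boxNorm x) V ^ (-(d : ℝ) - α)) ≤ f (W⁻¹ • rep x))
    {R : ℕ} (hRL : R < L) (hRV : (R : ℝ) ≤ V) : b * R ^ d ≤ Omega L W f := by
  have hV0 : 0 < V := by linarith
  obtain ⟨B, hB, hBc⟩ := exists_box (L := L) hd hRL
  have hf0 : ∀ x : Torus d L, 0 ≤ f (W⁻¹ • rep x) := fun x => by
    have : 0 < max (boxNorm x) V := hV0.trans_le (le_max_right _ _)
    exact le_trans (by positivity) (hf x)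
  calc b * (R : ℝ) ^ d ≤ b * #B := mul_le_mul_of_nonneg_left hBc hb
    _ = ∑ _x ∈ B, b := by rw [sum_const, nsmul_eq_mul, mul_comm]
    _ ≤ ∑ x ∈ B, f (W⁻¹ • rep x) := by
        refine sum_le_sum fun x hx => le_trans (le_of_eq ?_) (hf x)
        rw [max_eq_right ((hB x hx).2.trans hRV), ← Real.rpow_add hV0,
          show (d : ℝ) + α + (-(d : ℝ) - α) = 0 by ring, Real.rpow_zero, mul_one]
    _ ≤ Omega L W f := by
        refine sum_le_sum_of_subset_of_nonneg (fun x hx => ?_) fun x _ _ => hf0 x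
        exact mem_filter.2 ⟨mem_univ x, (hB x hx).1⟩

/-- Below the side of the torus, the walk has a stable-like kernel. -/
theorem exists_isStableKernel (hd : 1 ≤ d) {α : ℝ} (hα : α ∈ Set.Ioo (0 : ℝ) 2)
    (hfs : ∀ x, f (-x) = f x) {b₁ b₂ : ℝ} (hb₁ : 0 < b₁) (hb₂ : 0 < b₂) :
    ∃ c₁ c₂ : ℝ, 0 < c₁ ∧ 0 < c₂ ∧ ∀ (L : ℕ) [NeZero L] (W V : ℝ), 1 ≤ V → V < L →
      (∀ x : Torus d L,
        b₁ * (V ^ ((d : ℝ) + α) * max (boxNorm x) V ^ (-(d : ℝ) - α)) ≤ f (W⁻¹ • rep x) ∧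
        f (W⁻¹ • rep x) ≤ b₂ * (V ^ ((d : ℝ) + α) * max (boxNorm x) V ^ (-(d : ℝ) - α))) →
      IsStableKernel (stepLaw L W f) α V c₁ c₂ := by
  obtain ⟨K, hK, hsum⟩ := exists_sum_profile_le d hα
  -- The profile bounds divided by the two bounds on `Omega`, which is of order `V ^ d`; the `1 / 2`
  -- comes from `⌊V⌋₊ ≥ V / 2`.
  refine ⟨b₁ / (b₂ * K), b₂ / (b₁ * (1 / 2) ^ d), by positivity, by positivity, ?_⟩
  intro L _ W V hV hVL hf
  have hV0 : 0 < V := by linarith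
  have hm0 : ∀ x : Torus d L, 0 < max (boxNorm x) V := fun x => hV0.trans_le (le_max_right _ _)
  have hf0 : ∀ x : Torus d L, 0 ≤ f (W⁻¹ • rep x) := fun x => by
    have := hm0 x
    exact le_trans (by positivity) (hf x).1
  have hR1 : 1 ≤ ⌊V⌋₊ := Nat.le_floor (by simpa using hV)
  have hR1' : (1 : ℝ) ≤ ⌊V⌋₊ := by exact_mod_cast hR1
  have hRV : (⌊V⌋₊ : ℝ) ≤ V := Nat.floor_le hV0.le
  have hRL : ⌊V⌋₊ < L := by exact_mod_cast hRV.trans_lt hVL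
  have hhalf : 1 / 2 * V ≤ ⌊V⌋₊ := by linarith [Nat.lt_floor_add_one V]
  have hΩl : b₁ * (1 / 2) ^ d * V ^ d ≤ Omega L W f := by
    refine le_trans ?_ (le_Omega hd hV hb₁.le (fun x => (hf x).1) hRL hRV)
    rw [mul_assoc, ← mul_pow]
    exact mul_le_mul_of_nonneg_left (pow_le_pow_left₀ (by positivity) hhalf d) hb₁.le
  have hΩ0 : 0 < Omega L W f := lt_of_lt_of_le (by positivity) hΩl
  have hΩu : Omega L W f ≤ b₂ * K * V ^ d := by
    calc Omega L W f ≤ ∑ x : Torus d L, f (W⁻¹ • rep x) :=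
          sum_le_sum_of_subset_of_nonneg (filter_subset _ _) fun x _ _ => hf0 x
      _ ≤ ∑ x : Torus d L, b₂ * (V ^ ((d : ℝ) + α) * max (boxNorm x) V ^ (-(d : ℝ) - α)) :=
          sum_le_sum fun x _ => (hf x).2
      _ ≤ b₂ * K * V ^ d := by
          rw [← mul_sum, mul_assoc]
          exact mul_le_mul_of_nonneg_left (hsum L V hV) hb₂.le
  have hVd : V ^ ((d : ℝ) + α) = V ^ d * V ^ α := by rw [Real.rpow_add hV0, Real.rpow_natCast]
  refine ⟨fun x => ?_, sum_stepLaw hΩ0.ne', fun x hx => ?_, fun x => ?_, fun x hx => ?_⟩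
  · simp only [stepLaw]
    split_ifs
    · exact le_rfl
    · exact div_nonneg (hf0 x) hΩ0.le
  · rw [stepLaw, if_neg hx, le_div_iff₀ hΩ0]
    refine le_trans ?_ (hf x).1
    have := hm0 x
    calc b₁ / (b₂ * K) * (V ^ α * max (boxNorm x) V ^ (-(d : ℝ) - α)) * Omega L W f
        ≤ b₁ / (b₂ * K) * (V ^ α * max (boxNorm x) V ^ (-(d : ℝ) - α)) * (b₂ * K * V ^ d) :=
          mul_le_mul_of_nonneg_left hΩu (by positivity)
      _ = _ := by
          rw [hVd]
          field_simp
  · have := hm0 x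
    simp only [stepLaw]
    split_ifs
    · positivity
    · rw [div_le_iff₀ hΩ0]
      refine (hf x).2.trans ?_
      calc b₂ * (V ^ ((d : ℝ) + α) * max (boxNorm x) V ^ (-(d : ℝ) - α))
          = b₂ / (b₁ * (1 / 2) ^ d) * (V ^ α * max (boxNorm x) V ^ (-(d : ℝ) - α)) *
            (b₁ * (1 / 2) ^ d * V ^ d) := by
            rw [hVd]
            field_simp
        _ ≤ _ := mul_le_mul_of_nonneg_left hΩl (by positivity)
  · exact stepLaw_neg hfs hx

/-- Above the side of the torus, the walk is comparable with uniform sampling. -/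
theorem convPow_stepLaw_le_of_side_le (hd : 1 ≤ d) (hL : 2 ≤ L) {α V b₁ b₂ : ℝ} (hV : (L : ℝ) ≤ V)
    (hb₁ : 0 < b₁) (hb₂ : 0 < b₂)
    (hf : ∀ x : Torus d L,
        b₁ * (V ^ ((d : ℝ) + α) * max (boxNorm x) V ^ (-(d : ℝ) - α)) ≤ f (W⁻¹ • rep x) ∧
        f (W⁻¹ • rep x) ≤ b₂ * (V ^ ((d : ℝ) + α) * max (boxNorm x) V ^ (-(d : ℝ) - α)))
    {n : ℕ} (hn : 1 ≤ n) (x : Torus d L) :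
    convPow (stepLaw L W f) n x ≤ b₂ / (b₁ * (1 / 2) ^ d) * (1 / (L : ℝ) ^ d) := by
  have hL2 : (2 : ℝ) ≤ L := by exact_mod_cast hL
  have hV0 : 0 < V := by linarith
  have hprof : ∀ x : Torus d L, V ^ ((d : ℝ) + α) * max (boxNorm x) V ^ (-(d : ℝ) - α) = 1 := by
    intro x
    rw [max_eq_right (by linarith [boxNorm_le_half x]), ← Real.rpow_add hV0,
      show (d : ℝ) + α + (-(d : ℝ) - α) = 0 by ring, Real.rpow_zero]
  have hcast : ((L - 1 : ℕ) : ℝ) = L - 1 := by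
    rw [Nat.cast_sub (by lia), Nat.cast_one]
  have hΩl : b₁ * (1 / 2) ^ d * (L : ℝ) ^ d ≤ Omega L W f := by
    -- `L - 1` is the largest admissible side, and it is at least `L / 2` because `L ≥ 2`.
    refine le_trans ?_ (le_Omega (R := L - 1) hd (by linarith : 1 ≤ V) hb₁.le
      (fun x => (hf x).1) (by lia) (by rw [hcast]; linarith))
    rw [mul_assoc, ← mul_pow, hcast]
    exact mul_le_mul_of_nonneg_left (pow_le_pow_left₀ (by positivity) (by linarith) d) hb₁.le
  have hΩ0 : 0 < Omega L W f := lt_of_lt_of_le (by positivity) hΩl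
  simp only [hprof, mul_one] at hf
  have h0 : ∀ x, 0 ≤ stepLaw L W f x := by
    intro x
    simp only [stepLaw]
    split_ifs
    · exact le_rfl
    · exact div_nonneg (hb₁.le.trans (hf x).1) hΩ0.le
  obtain ⟨k, rfl⟩ := Nat.exists_eq_add_of_le' hn
  refine convPow_succ_le_of_forall_le h0 (sum_stepLaw hΩ0.ne') (fun x => ?_) k x
  simp only [stepLaw]
  split_ifs
  · positivity
  · rw [div_le_iff₀ hΩ0]
    refine (hf x).2.trans ?_
    calc b₂ = b₂ / (b₁ * (1 / 2) ^ d) * (1 / (L : ℝ) ^ d) * (b₁ * (1 / 2) ^ d * (L : ℝ) ^ d) := by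
          field_simp
      _ ≤ _ := mul_le_mul_of_nonneg_left hΩl (by positivity)

/-- The stable tail at the scale `max W 1` in the box norm, compared with the one at the
scale `W` in the Euclidean norm. -/
theorem exists_tail_le (hd : 1 ≤ d) {α W₀ : ℝ} (hα : 0 < α) (hW₀ : 0 < W₀) :
    ∃ K : ℝ, 0 < K ∧ ∀ (L : ℕ) [NeZero L] (W : ℝ), W₀ ≤ W → ∀ x : Torus d L,
      max W 1 ^ α * max (boxNorm x) (max W 1) ^ (-(d : ℝ) - α) ≤
        K * (W ^ α / max (torusNorm x) W ^ ((d : ℝ) + α)) := by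
  have hd1 : (1 : ℝ) ≤ d := by exact_mod_cast hd
  have hsd : 1 ≤ √(d : ℝ) := Real.one_le_sqrt.2 hd1
  have hsd0 : 0 < √(d : ℝ) := by linarith
  set w := min W₀ 1 with hw
  have hw0 : 0 < w := lt_min hW₀ one_pos
  have hw1 : w ≤ 1 := min_le_right _ _
  refine ⟨w⁻¹ ^ α * √d ^ ((d : ℝ) + α), by positivity, ?_⟩
  intro L _ W hW x
  have hW0 : 0 < W := hW₀.trans_le hW
  have hVW : max W 1 ≤ w⁻¹ * W := by
    rw [inv_mul_eq_div, le_div_iff₀ hw0]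
    refine (max_mul_of_nonneg W 1 hw0.le).trans_le (max_le (by nlinarith) ?_)
    rw [one_mul]
    exact (min_le_left _ _).trans hW
  have hm : max (torusNorm x) W / √d ≤ max (boxNorm x) (max W 1) := by
    rw [div_le_iff₀ hsd0]
    refine max_le ?_ ?_
    · refine (torusNorm_le_sqrt_mul_boxNorm x).trans ?_
      rw [mul_comm]
      exact mul_le_mul_of_nonneg_right (le_max_left _ _) hsd0.le
    · have h1 : W ≤ max (boxNorm x) (max W 1) := (le_max_left W 1).trans (le_max_right _ _)
      nlinarith
  have hM0 : 0 < max (torusNorm x) W := hW0.trans_le (le_max_right _ _)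
  have h1 : max W 1 ^ α ≤ w⁻¹ ^ α * W ^ α := by
    rw [← Real.mul_rpow (by positivity) hW0.le]
    exact Real.rpow_le_rpow (by positivity) hVW hα.le
  have h2 : max (boxNorm x) (max W 1) ^ (-(d : ℝ) - α) ≤
      √d ^ ((d : ℝ) + α) * (max (torusNorm x) W ^ ((d : ℝ) + α))⁻¹ := by
    refine (Real.rpow_le_rpow_of_nonpos (by positivity) hm (by linarith)).trans (le_of_eq ?_)
    rw [show -(d : ℝ) - α = -((d : ℝ) + α) by ring, Real.rpow_neg (by positivity),
      Real.div_rpow hM0.le hsd0.le, inv_div, div_eq_mul_inv]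
  calc max W 1 ^ α * max (boxNorm x) (max W 1) ^ (-(d : ℝ) - α)
      ≤ w⁻¹ ^ α * W ^ α * (√d ^ ((d : ℝ) + α) * (max (torusNorm x) W ^ ((d : ℝ) + α))⁻¹) := by
        refine mul_le_mul h1 h2 (Real.rpow_nonneg ?_ _) (by positivity)
        exact (boxNorm_nonneg x).trans (le_max_left _ _)
    _ = _ := by rw [div_eq_mul_inv]; ring

end Walk

end CirculantWalk

/-! ### Assembly of the bounds. -/

open CirculantWalk

theorem mainTheorem2 (d : ℕ) (hd : 1 ≤ d) (α : ℝ) (hα : α ∈ Set.Ioo (0 : ℝ) 2)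
    (f : EuclideanSpace ℝ (Fin d) → ℝ) (hf : CirculantWalk.IsSymmetricDensity f)
    (hfα : CirculantWalk.Comparable f fun x => (max ‖x‖ 1) ^ (-(d : ℝ) - α))
    (W₀ : ℝ) (hW₀ : 0 < W₀) :
    ∃ C : ℝ, 0 < C ∧
      ∀ (L : ℕ) [NeZero L], 2 ≤ L → ∀ W : ℝ, W₀ ≤ W → ∀ n : ℕ, 1 ≤ n →
        ∀ x : CirculantWalk.Torus d L,
          CirculantWalk.stepProb L W f n x ≤
            C * (min (1 / ((n : ℝ) ^ ((d : ℝ) / α) * W ^ d))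
                  ((n : ℝ) * W ^ α / (max (CirculantWalk.torusNorm x) W) ^ ((d : ℝ) + α))
                + 1 / (L : ℝ) ^ d) := by
  have hα0 : 0 < α := hα.1
  obtain ⟨b₁, b₂, hb₁, hb₂, hb⟩ := exists_profile_bounds hd hα0 hW₀ hfα
  obtain ⟨c₁, c₂, hc₁, hc₂, hc⟩ := exists_isStableKernel hd hα hf.symm hb₁ hb₂
  obtain ⟨A, hA, hdiag⟩ := exists_convPow_le hd hα0 hc₁ hc₂
  obtain ⟨C, hC, hoff⟩ := exists_convPow_le_offDiagonal hd hα hc₁ hc₂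
  obtain ⟨K, hK, htail⟩ := exists_tail_le hd hα0 hW₀
  set M : ℝ := b₂ / (b₁ * (1 / 2) ^ d) with hM
  have hM0 : 0 < M := by positivity
  have hK1 : 0 < K + 1 := by linarith
  refine ⟨A + C * (K + 1) + M, by positivity, ?_⟩
  intro L _ hL W hW n hn x
  have hW0 : 0 < W := hW₀.trans_le hW
  have hL0 : (0 : ℝ) < L := by exact_mod_cast (by lia : 0 < L)
  have hn0 : (0 : ℝ) < n := by exact_mod_cast hn
  have hN : 0 < 1 / (L : ℝ) ^ d := by positivity
  have hm0 : 0 < max (torusNorm x) W := hW0.trans_le (le_max_right _ _)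
  rw [stepProb_eq_convPow]
  -- Below the side, both branches of the minimum hold separately. Above it, the term `1 / L ^ d`
  -- alone suffices.
  rcases lt_or_ge (max W 1) (L : ℝ) with hVL | hVL
  · have hV : 1 ≤ max W 1 := le_max_right _ _
    have hp := hc L W (max W 1) hV hVL (hb L W hW)
    have h1 : convPow (stepLaw L W f) n x ≤
        (A + C * (K + 1) + M) * (1 / ((n : ℝ) ^ ((d : ℝ) / α) * W ^ d) + 1 / (L : ℝ) ^ d) := by
      refine (hdiag L hL _ hV _ hp n hn x).trans ?_
      have h2 : ((n : ℝ) * max W 1 ^ α) ^ (-((d : ℝ) / α)) ≤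
          1 / ((n : ℝ) ^ ((d : ℝ) / α) * W ^ d) := by
        refine (Real.rpow_le_rpow_of_nonpos (y := (n : ℝ) * max W 1 ^ α)
          (x := (n : ℝ) * W ^ α) (by positivity) ?_ (neg_nonpos.2 (by positivity))).trans
          (le_of_eq ?_)
        · exact mul_le_mul_of_nonneg_left
            (Real.rpow_le_rpow hW0.le (le_max_left _ _) hα0.le) hn0.le
        · rw [Real.rpow_neg (by positivity), Real.mul_rpow hn0.le (by positivity),
            ← Real.rpow_mul hW0.le, mul_div_cancel₀ _ hα0.ne', Real.rpow_natCast, one_div]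
      have hC0 : 0 ≤ C * (K + 1) := by positivity
      exact mul_le_mul (by linarith) (by linarith) (by positivity) (by positivity)
    have h2 : convPow (stepLaw L W f) n x ≤ (A + C * (K + 1) + M) *
        ((n : ℝ) * W ^ α / (max (torusNorm x) W) ^ ((d : ℝ) + α) + 1 / (L : ℝ) ^ d) := by
      refine (hoff L hL _ hV _ hp n hn x).trans ?_
      have h3 := mul_le_mul_of_nonneg_left (htail L W hW x) hn0.le
      set Y : ℝ := (n : ℝ) * W ^ α / (max (torusNorm x) W) ^ ((d : ℝ) + α) with hY
      have hY0 : 0 ≤ Y := by positivity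
      have h4 : (n : ℝ) * (K * (W ^ α / max (torusNorm x) W ^ ((d : ℝ) + α))) = K * Y := by
        rw [hY]; ring
      rw [h4, ← mul_assoc] at h3
      calc C * ((n : ℝ) * max W 1 ^ α * max (boxNorm x) (max W 1) ^ (-(d : ℝ) - α) +
            1 / (L : ℝ) ^ d) ≤ C * (K * Y + 1 / (L : ℝ) ^ d) :=
            mul_le_mul_of_nonneg_left (by linarith) hC.le
        _ ≤ C * ((K + 1) * (Y + 1 / (L : ℝ) ^ d)) :=
            mul_le_mul_of_nonneg_left (by nlinarith) hC.le
        _ ≤ (A + C * (K + 1) + M) * (Y + 1 / (L : ℝ) ^ d) := by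
            rw [← mul_assoc]
            exact mul_le_mul_of_nonneg_right (by linarith) (by positivity)
    rcases min_choice (1 / ((n : ℝ) ^ ((d : ℝ) / α) * W ^ d))
      ((n : ℝ) * W ^ α / (max (torusNorm x) W) ^ ((d : ℝ) + α)) with h | h
    · rw [h]
      exact h1
    · rw [h]
      exact h2
  · refine (convPow_stepLaw_le_of_side_le hd hL hVL hb₁ hb₂ (hb L W hW) hn x).trans ?_
    have h1 : 0 ≤ min (1 / ((n : ℝ) ^ ((d : ℝ) / α) * W ^ d))
        ((n : ℝ) * W ^ α / (max (torusNorm x) W) ^ ((d : ℝ) + α)) :=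
      le_min (by positivity) (by positivity)
    have hC0 : 0 ≤ C * (K + 1) := by positivity
    exact mul_le_mul (by linarith) (by linarith) hN.le (by positivity)
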